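/- Let $S$ be a locally compact Hausdorff semitopological semigroup (i.e. the multiplication $S\times S\to S$ is separately continuous) with identity. Let $M(S)$ be the space of all bounded regular Borel measures on $S$ with values in the scalar field $\mathbb K$ ($\mathbb K=\mathbb R$ or $\mathbb C$), with the total variation norm and the convolution product $\mu*\nu$ determined by $\int f\,d(\mu*\nu)=\int\!\int f(xy)\,d\nu(y)\,d\mu(x)$ for all $f\in C_0(S)$; let $M_0(S)\subseteq M(S)$ be the set of probability measures, and $\delta_x$ the point mass at $x$. For $f\in M(S)^*$ and $\mu\in M(S)$ define $f\mu\in M(S)^*$ by $\langle f\mu,\nu\rangle=\langle f,\mu*\nu\rangle$, and let $1\in M(S)^*$ be $\langle 1,\mu\rangle=\mu(S)$. A functional $M\in M(S)^{**}$ is a mean if $\langle M,1\rangle=1$ and $\langle M,f\rangle\ge 0$ for every $f\in M(S)^*$ that is nonnegative on positive measures; a mean $M$ is topologically left invariant if $\langle M,f\mu\rangle=\langle M,f\rangle$ for all $\mu\in M_0(S)$ and $f\in M(S)^*$. Assume that $S$ is semifoundation, i.e. there is $\nu\in M_0(S)$ such that $x\mapsto\delta_x*\nu$ is continuous from $S$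 into $M(S)$ with the norm topology. Then the following are equivalent: (1) $M(S)^*$ has a topologically left invariant mean; (2) for all integers $n\ge 1$ and all $\mu_1,\dots,\mu_n\in M(S)$, $$\inf_{\mu\in M_0(S)}\ \max_{1\le i\le n}\|\mu_i*\mu\|\ \le\ \max_{1\le i\le n}|\mu_i(S)|.$$ -/

import Mathlib

open MeasureTheory
open scoped ENNReal NNReal ZeroAtInfty

namespace SemigroupMeasureAlgebra

/-- A finite measure dominated by a finite compact-inner-regular measure is regular. -/
theorem regular_of_le {S : Type*} [TopologicalSpace S] [T2Space S] [MeasurableSpace S]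
    [BorelSpace S] {ρ σ : Measure S} [IsFiniteMeasure σ] [σ.InnerRegular] (h : ρ ≤ σ) :
    ρ.Regular := by
  have : IsFiniteMeasure ρ := isFiniteMeasure_of_le σ h
  have : ρ.InnerRegular := by
    refine ⟨fun A hA r hr => ?_⟩
    have hr' : ρ A - r ≠ 0 := (tsub_pos_of_lt hr).ne'
    obtain ⟨K, hKA, hK, hlt⟩ := hA.exists_isCompact_sdiff_lt (μ := σ) (measure_ne_top σ A) hr'
    refine ⟨K, hKA, hK, ?_⟩
    have h1 : ρ (A \ K) < ρ A - r := (h _).trans_lt hlt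
    have h2 : ρ A ≤ ρ K + ρ (A \ K) := by
      rw [measure_add_sdiff hK.measurableSet.nullMeasurableSet,
        Set.union_eq_self_of_subset_left hKA]
    by_contra hcon
    rw [not_lt] at hcon
    have h3 : r + ρ (A \ K) < ρ A := by
      rw [add_comm]; exact lt_tsub_iff_right.mp h1
    exact absurd (h2.trans (by gcongr)) (not_le.mpr h3)
  infer_instance

section

variable (𝕜 : Type*) [RCLike 𝕜] (S : Type*) [TopologicalSpace S] [T2Space S] [MeasurableSpace S]
  [BorelSpace S]

/-- The linear space of all bounded regular Borel measures on `S` with values in the scalar field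
`𝕜` (`ℝ` or `ℂ`): countably additive set functions on the Borel sets whose total variation measure
is finite and regular. -/
def regularMeasures : Submodule 𝕜 (VectorMeasure S 𝕜) where
  carrier := {μ | IsFiniteMeasure μ.variation ∧ μ.variation.Regular}
  zero_mem' := by
    simp only [Set.mem_ofPred_eq, VectorMeasure.variation_zero]
    exact ⟨inferInstance, inferInstance⟩
  add_mem' := by
    rintro μ ν ⟨_, _⟩ ⟨_, _⟩
    exact ⟨isFiniteMeasure_of_le _ VectorMeasure.variation_add_le,
      regular_of_le VectorMeasure.variation_add_le⟩
  smul_mem' := by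
    rintro c μ ⟨_, _⟩
    simp only [Set.mem_ofPred_eq, VectorMeasure.variation_smul]
    exact ⟨inferInstance, inferInstance⟩

/-- The space `M(S)` of bounded regular Borel measures on `S`. -/
def MeasureSpaceOn : Type _ := regularMeasures 𝕜 S

noncomputable instance : AddCommGroup (MeasureSpaceOn 𝕜 S) :=
  inferInstanceAs (AddCommGroup (regularMeasures 𝕜 S))

noncomputable instance : Module 𝕜 (MeasureSpaceOn 𝕜 S) :=
  inferInstanceAs (Module 𝕜 (regularMeasures 𝕜 S))

variable {𝕜 S}

/-- The underlying set function of an element of `M(S)`. -/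
def MeasureSpaceOn.toVM (μ : MeasureSpaceOn 𝕜 S) : VectorMeasure S 𝕜 := Subtype.val μ

instance (μ : MeasureSpaceOn 𝕜 S) : IsFiniteMeasure μ.toVM.variation := (Subtype.property μ).1

/-- The total variation norm `‖μ‖ = |μ|(S)`. -/
noncomputable instance : Norm (MeasureSpaceOn 𝕜 S) :=
  ⟨fun μ => (μ.toVM.variation Set.univ).toReal⟩

theorem normCore : NormedSpace.Core 𝕜 (MeasureSpaceOn 𝕜 S) where
  norm_nonneg _ := ENNReal.toReal_nonneg
  norm_smul c μ := by
    change ((c • μ.toVM).variation Set.univ).toReal = ‖c‖ * (μ.toVM.variation Set.univ).toReal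
    rw [VectorMeasure.variation_smul]
    simp
  norm_triangle μ ν := by
    change ((μ.toVM + ν.toVM).variation Set.univ).toReal ≤
      (μ.toVM.variation Set.univ).toReal + (ν.toVM.variation Set.univ).toReal
    rw [← ENNReal.toReal_add (measure_ne_top _ _) (measure_ne_top _ _)]
    exact ENNReal.toReal_mono (by finiteness) (VectorMeasure.variation_add_le Set.univ)
  norm_eq_zero_iff μ := by
    change (μ.toVM.variation Set.univ).toReal = 0 ↔ _
    rw [ENNReal.toReal_eq_zero_iff, or_iff_left (measure_ne_top _ _), Measure.measure_univ_eq_zero,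
      VectorMeasure.variation_eq_zero]
    exact (Subtype.ext_iff (a1 := μ) (a2 := (0 : regularMeasures 𝕜 S))).symm

noncomputable instance : NormedAddCommGroup (MeasureSpaceOn 𝕜 S) :=
  NormedAddCommGroup.ofCore (normCore (𝕜 := 𝕜))

noncomputable instance : NormedSpace 𝕜 (MeasureSpaceOn 𝕜 S) :=
  NormedSpace.ofCore normCore

/-- The integral `∫ f dμ` of a scalar function against `μ ∈ M(S)`. -/
noncomputable def integral (μ : MeasureSpaceOn 𝕜 S) (f : S → 𝕜) : 𝕜 :=
  μ.toVM.integral f (ContinuousLinearMap.mul ℝ 𝕜)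

variable (𝕜) in
/-- The point mass `δ_x`. -/
noncomputable def pointMass (x : S) : MeasureSpaceOn 𝕜 S :=
  ⟨VectorMeasure.dirac x 1, by
    have h : (VectorMeasure.dirac x (1 : 𝕜)).variation ≤ Measure.dirac x := by
      rw [VectorMeasure.variation_dirac]; simp
    have : (Measure.dirac x).InnerRegular := by
      refine ⟨fun A hA r hr => ?_⟩
      by_cases hx : x ∈ A
      · exact ⟨{x}, by simpa using hx, isCompact_singleton, hr.trans_le (by simp [hx])⟩
      · simp [hA, hx] at hr
    exact ⟨isFiniteMeasure_of_le _ h, regular_of_le h⟩⟩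

open scoped ComplexOrder in
/-- A measure in `M(S)` is positive if all its values are nonnegative real numbers. -/
def IsPositive (μ : MeasureSpaceOn 𝕜 S) : Prop := ∀ E : Set S, MeasurableSet E → 0 ≤ μ.toVM E

variable (𝕜 S) in
/-- The set `M₀(S)` of probability measures in `M(S)`. -/
def probabilityMeasures : Set (MeasureSpaceOn 𝕜 S) := {μ | IsPositive μ ∧ μ.toVM Set.univ = 1}

open scoped Classical in
/-- The convolution `μ * ν`: the regular measure such that
`∫ f d(μ * ν) = ∫ ∫ f (x y) dν(y) dμ(x)` for every `f ∈ C₀(S)`. (For a separately continuous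
multiplication on a locally compact Hausdorff space there is exactly one such measure, so the
value `0` in the other case is never taken.) -/
noncomputable def conv [Mul S] (μ ν : MeasureSpaceOn 𝕜 S) : MeasureSpaceOn 𝕜 S :=
  if h : ∃ ρ : MeasureSpaceOn 𝕜 S, ∀ f : C₀(S, 𝕜),
      integral ρ f = integral μ fun x => integral ν fun y => f (x * y)
  then h.choose else 0

variable (𝕜 S) in
/-- `S` is semifoundation: for some probability measure `ν ∈ M₀(S)` the map `x ↦ δ_x * ν` is
continuous from `S` to `M(S)` with the variation norm. -/
def IsSemifoundation [Mul S] : Prop :=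
  ∃ ν ∈ probabilityMeasures 𝕜 S, Continuous fun x : S => conv (pointMass 𝕜 x) ν

open scoped ComplexOrder in
/-- A functional `f ∈ M(S)*` is positive if it is nonnegative on positive measures. -/
def IsPositiveFunctional (f : StrongDual 𝕜 (MeasureSpaceOn 𝕜 S)) : Prop :=
  ∀ μ : MeasureSpaceOn 𝕜 S, IsPositive μ → 0 ≤ f μ

variable (𝕜 S) in
/-- The functional `1 ∈ M(S)*`, that is, `μ ↦ μ(S)`. -/
noncomputable def totalMass : StrongDual 𝕜 (MeasureSpaceOn 𝕜 S) :=
  LinearMap.mkContinuous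
    { toFun := fun μ => μ.toVM Set.univ
      map_add' := fun _ _ => rfl
      map_smul' := fun _ _ => rfl } 1 fun μ => by
    rw [one_mul]
    exact VectorMeasure.norm_measure_le_variation

open scoped ComplexOrder in
/-- `M ∈ M(S)**` is a mean: `⟨M, f⟩ ≥ 0` for `f ≥ 0`, and `⟨M, 1⟩ = 1`. -/
def IsMean (M : StrongDual 𝕜 (StrongDual 𝕜 (MeasureSpaceOn 𝕜 S))) : Prop :=
  (∀ f, IsPositiveFunctional f → 0 ≤ M f) ∧ M (totalMass 𝕜 S) = 1

/-- `M` is topologically left invariant: `⟨M, f μ⟩ = ⟨M, f⟩` for all `μ ∈ M₀(S)` and `f ∈ M(S)*`.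
Here `g` is the functional `f μ`, that is, `⟨g, ν⟩ = ⟨f, μ * ν⟩` for all `ν`. -/
def IsTopologicallyLeftInvariant [Mul S]
    (M : StrongDual 𝕜 (StrongDual 𝕜 (MeasureSpaceOn 𝕜 S))) : Prop :=
  ∀ μ ∈ probabilityMeasures 𝕜 S, ∀ f g : StrongDual 𝕜 (MeasureSpaceOn 𝕜 S),
    (∀ ν, g ν = f (conv μ ν)) → M g = M f

end

end SemigroupMeasureAlgebra

/-! A mean yields the inequality by a Hahn–Banach argument. For probability measures `p i`, the
vectors `(p i * μ - μ)_i`, with `μ` probability, form a convex set. If 0 were outside its norm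
closure, a functional would have real part at least some `u > 0` on this set. Composed with `μ ↦ (p
i * μ - μ)_i`, it becomes a sum of terms `F p - F`, which an invariant mean kills, while a mean
respects the lower bound `u`. So some `μ` is almost fixed by all `p i`
(`IsMean.exists_norm_conv_sub_lt`). As `M(S)` is spanned by probability measures, `μ_i * μ` is then
close to `μ_i(S) μ`, whose norm is `|μ_i(S)|`.

Conversely, the inequality for the measures `p i - δ_1`, which have total mass 0, makes `‖p i * μ -
μ‖` small; a weak-star limit of such `μ` is an invariant mean
(`exists_topologicallyLeftInvariant_mean`).

Most of the work is to show that `conv` is a genuine bounded bilinear product. With multiplication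
only separately continuous, the continuity of `x ↦ ∫ f (x y) dν(y)` is the delicate point
(`continuous_integral_mul`); it rests on a double-limit argument that replaces nets by sequences.
Riesz–Markov–Kakutani then represents the iterated integral. -/

namespace SemigroupMeasureAlgebra

/-! ### Separately continuous functions: sequences in place of nets. -/

section SeparateContinuity

open Filter Topology

/-- A compact set has finite subsets that are dense for finitely many continuous functions. -/
theorem exists_finset_dist_lt {X Y Z : Type*} [TopologicalSpace Y] [PseudoMetricSpace Z]
    {f : X → Y → Z} (hy : ∀ x, Continuous (f x)) {K : Set Y} (hK : IsCompact K) (F : Finset X)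
    {ε : ℝ} (hε : 0 < ε) :
    ∃ T : Finset Y, (∀ t ∈ T, t ∈ K) ∧ ∀ y ∈ K, ∃ t ∈ T, ∀ x ∈ F, dist (f x y) (f x t) < ε := by
  obtain ⟨T, hTK, hT⟩ := hK.elim_nhds_subcover
    (fun t => ⋂ x ∈ F, {y | dist (f x y) (f x t) < ε}) fun t _ => by
      refine (Filter.biInter_finset_mem F).2 fun x _ => ?_
      exact (isOpen_lt ((hy x).dist continuous_const) continuous_const).mem_nhds (by simpa)
  refine ⟨T, hTK, fun y hyK => ?_⟩
  obtain ⟨t, ht, hyt⟩ := Set.mem_iUnion₂.1 (hT hyK)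
  exact ⟨t, ht, fun x hx => Set.mem_iInter₂.1 hyt x hx⟩

/-- If `f` is separately continuous and `x₀` is in the closure of a relatively compact set `A`,
then some sequence `xₙ` in `A` satisfies `f (xₙ, y) → f (x₀, y)` for all `y` in a given compact
set. -/
theorem exists_seq_tendsto_of_separatelyContinuous {X Y Z : Type*} [TopologicalSpace X]
    [TopologicalSpace Y] [MetricSpace Z] {f : X → Y → Z} (hx : ∀ y, Continuous fun x => f x y)
    (hy : ∀ x, Continuous (f x)) {A C : Set X} (hC : IsCompact C) (hAC : A ⊆ C) {x₀ : X}
    (hx₀ : x₀ ∈ closure A) {K : Set Y} (hK : IsCompact K) :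
    ∃ x : ℕ → X, (∀ n, x n ∈ A) ∧
      ∀ y ∈ K, Tendsto (fun n => f (x n) y) atTop (𝓝 (f x₀ y)) := by
  classical
  have hpos (n : ℕ) : (0 : ℝ) < 1 / ((n : ℝ) + 1) := Nat.one_div_pos_of_nat
  have hlim : Tendsto (fun n : ℕ => 1 / ((n : ℝ) + 1)) atTop (𝓝 0) :=
    tendsto_one_div_add_atTop_nhds_zero_nat
  choose T hTK hT using fun (F : Finset X) (n : ℕ) => exists_finset_dist_lt hy hK F (hpos n)
  have hnext (D : Finset Y) (n : ℕ) :
      ∃ a ∈ A, ∀ y ∈ D, dist (f a y) (f x₀ y) < 1 / ((n : ℝ) + 1) := by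
    have hU : (⋂ y ∈ D, {a | dist (f a y) (f x₀ y) < 1 / ((n : ℝ) + 1)}) ∈ 𝓝 x₀ := by
      refine (Filter.biInter_finset_mem D).2 fun y _ => ?_
      exact (isOpen_lt ((hx y).dist continuous_const) continuous_const).mem_nhds
        (by simpa using hpos n)
    obtain ⟨a, ha, haA⟩ := mem_closure_iff_nhds.1 hx₀ _ hU
    exact ⟨a, haA, fun y hyD => Set.mem_iInter₂.1 ha y hyD⟩
  choose a haA ha using hnext
  -- The state holds finite sets of points of `X` and of `Y`. Stage `n` first adds to the second set
  -- a net of `K` that is `1/(n+1)`-fine for the points of `X` so far, then picks `x n` close to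
  -- `x₀` on the enlarged set; hence `x n` uses `(st (n + 1)).2`.
  let st : ℕ → Finset X × Finset Y := fun n => Nat.rec ({x₀}, ∅)
    (fun n s => (insert (a (s.2 ∪ T s.1 n) n) s.1, s.2 ∪ T s.1 n)) n
  let x : ℕ → X := fun n => a (st (n + 1)).2 n
  have hst1 (n : ℕ) : (st (n + 1)).1 = insert (x n) (st n).1 := rfl
  have hst2 (n : ℕ) : (st (n + 1)).2 = (st n).2 ∪ T (st n).1 n := rfl
  have hm1 : Monotone fun n => (st n).1 :=
    monotone_nat_of_le_succ fun n => by rw [hst1]; exact Finset.subset_insert _ _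
  have hm2 : Monotone fun n => (st n).2 :=
    monotone_nat_of_le_succ fun n => by rw [hst2]; exact Finset.subset_union_left
  have hx₀mem (n : ℕ) : x₀ ∈ (st n).1 := hm1 (Nat.zero_le n) (Finset.mem_singleton_self x₀)
  have hxmem {j n : ℕ} (h : j < n) : x j ∈ (st n).1 :=
    hm1 (Nat.succ_le_of_lt h) (by simp only [hst1]; exact Finset.mem_insert_self _ _)
  refine ⟨x, fun n => haA _ _, fun y hyK => ?_⟩
  rw [tendsto_iff_ultrafilter]
  intro U hU
  -- Let `t n` be the net point near `y`, and `x'`, `y'` the limits of `x n`, `t n` along `U`. The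
  -- points `y'` and `y` are indistinguishable for `x₀` and every `x j`, and `x'` and `x₀` for every
  -- `t m`. Taking limits in each variable separately yields `f x' y = f x' y' = f x₀ y' = f x₀ y`.
  choose t htT ht using fun n => hT (st n).1 n y hyK
  obtain ⟨x', -, hx'⟩ := hC.ultrafilter_le_nhds (U.map x)
    (le_principal_iff.2 (Filter.mem_map.2 (Filter.univ_mem' fun n => hAC (haA _ _))))
  obtain ⟨y', -, hy'⟩ := hK.ultrafilter_le_nhds (U.map t)
    (le_principal_iff.2 (Filter.mem_map.2 (Filter.univ_mem' fun n => hTK _ _ _ (htT n))))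
  have hUx (z : Y) : Tendsto (fun n => f (x n) z) U (𝓝 (f x' z)) :=
    ((hx z).tendsto x').comp hx'
  have hUy (z : X) : Tendsto (fun n => f z (t n)) U (𝓝 (f z y')) :=
    ((hy z).tendsto y').comp hy'
  have key (z : X) (hz : ∀ᶠ n in atTop, z ∈ (st n).1) : f z y' = f z y := by
    refine tendsto_nhds_unique (hUy z) ((tendsto_iff_dist_tendsto_zero.2 ?_).mono_left hU)
    refine squeeze_zero' (.of_forall fun _ => dist_nonneg) ?_ hlim
    filter_upwards [hz] with n hn
    rw [dist_comm]
    exact (ht n z hn).le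
  have h1 (j : ℕ) : f (x j) y' = f (x j) y :=
    key _ ((eventually_gt_atTop j).mono fun n hn => hxmem hn)
  have h2 : f x₀ y' = f x₀ y := key _ (.of_forall hx₀mem)
  have h3 (m : ℕ) : f x' (t m) = f x₀ (t m) := by
    refine tendsto_nhds_unique (hUx _) ((tendsto_iff_dist_tendsto_zero.2 ?_).mono_left hU)
    refine squeeze_zero' (.of_forall fun _ => dist_nonneg) ?_ hlim
    filter_upwards [eventually_ge_atTop m] with n hn
    refine (ha _ _ _ (hm2 (Nat.succ_le_succ hn) ?_)).le
    simp only [hst2]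
    exact Finset.mem_union_right _ (htT m)
  have h4 : f x' y' = f x₀ y' :=
    tendsto_nhds_unique (hUy x') ((hUy x₀).congr fun m => (h3 m).symm)
  have h5 : f x' y = f x' y' :=
    tendsto_nhds_unique (hUx y) ((hUx y').congr h1)
  rw [← h2, ← h4, ← h5]
  exact hUx y

/-- The `L¹`-distance of the sections of a bounded separately continuous function is continuous. -/
theorem tendsto_integral_norm_sub_of_separatelyContinuous {X Y E : Type*} [TopologicalSpace X]
    [LocallyCompactSpace X] [TopologicalSpace Y] [T2Space Y] [MeasurableSpace Y] [BorelSpace Y]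
    [NormedAddCommGroup E] [SecondCountableTopology E] {f : X → Y → E}
    (hx : ∀ y, Continuous fun x => f x y) (hy : ∀ x, Continuous (f x)) {B : ℝ}
    (hB : ∀ x y, ‖f x y‖ ≤ B) (m : Measure Y) [IsFiniteMeasure m] [m.InnerRegular] (x₀ : X) :
    Tendsto (fun x => ∫ y, ‖f x y - f x₀ y‖ ∂m) (𝓝 x₀) (𝓝 0) := by
  borelize E
  have hB0 (x : X) (y : Y) : ‖f x y - f x₀ y‖ ≤ 2 * B :=
    (norm_sub_le _ _).trans (by linarith [hB x y, hB x₀ y])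
  have hmeas (x : X) : Continuous fun y => ‖f x y - f x₀ y‖ := ((hy x).sub (hy x₀)).norm
  have hint (x : X) : Integrable (fun y => ‖f x y - f x₀ y‖) m :=
    Integrable.of_bound (hmeas x).aestronglyMeasurable (2 * B)
      (.of_forall fun y => by simpa using hB0 x y)
  -- Dominated convergence needs sequences, and `𝓝 x₀` may have no countable basis. A failure of the
  -- limit puts `x₀` in the closure of a set of bad points inside a compact set, from which the
  -- previous lemma extracts a sequence.
  by_contra hcon
  obtain ⟨C, hC, hCx⟩ := exists_compact_mem_nhds x₀
  obtain ⟨ε, hε, hfreq⟩ : ∃ ε > 0, ∃ᶠ x in 𝓝 x₀, ε ≤ ∫ y, ‖f x y - f x₀ y‖ ∂m := by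
    rw [Metric.tendsto_nhds] at hcon
    push Not at hcon
    obtain ⟨ε, hε, h⟩ := hcon
    refine ⟨ε, hε, h.mono fun x hx => ?_⟩
    rwa [Real.dist_0_eq_abs, abs_of_nonneg (integral_nonneg fun _ => norm_nonneg _)] at hx
  have hx₀ : x₀ ∈ closure {x | x ∈ C ∧ ε ≤ ∫ y, ‖f x y - f x₀ y‖ ∂m} :=
    mem_closure_iff_frequently.2 ((hfreq.and_eventually hCx).mono fun x hx => ⟨hx.2, hx.1⟩)
  -- The sequence converges only over a compact set; inner regularity makes the rest negligible. The
  -- denominator `2 * |B| + 1` is positive whatever `B` is.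
  obtain ⟨K, hK, hKm⟩ : ∃ K, IsCompact K ∧ m.real Kᶜ * (2 * B) < ε / 2 := by
    have hpos : 0 < ε / 2 / (2 * |B| + 1) := by positivity
    obtain ⟨K, -, hK, hlt⟩ := MeasurableSet.univ.exists_isCompact_sdiff_lt (μ := m)
      (measure_ne_top m _) (ENNReal.ofReal_pos.2 hpos).ne'
    refine ⟨K, hK, ?_⟩
    rw [← Set.compl_eq_univ_sdiff] at hlt
    have h1 : m.real Kᶜ < ε / 2 / (2 * |B| + 1) := by
      rw [measureReal_def]
      exact (ENNReal.lt_ofReal_iff_toReal_lt (measure_ne_top m _)).1 hlt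
    calc m.real Kᶜ * (2 * B) ≤ m.real Kᶜ * (2 * |B| + 1) := by
          gcongr; linarith [le_abs_self B]
      _ < ε / 2 / (2 * |B| + 1) * (2 * |B| + 1) := by gcongr
      _ = ε / 2 := by field_simp
  obtain ⟨x, hxA, hxK⟩ := exists_seq_tendsto_of_separatelyContinuous hx hy hC
    (fun x hx => hx.1) hx₀ hK
  have hlim : Tendsto (fun n => ∫ y in K, ‖f (x n) y - f x₀ y‖ ∂m) atTop (𝓝 0) := by
    have := tendsto_integral_of_dominated_convergence (μ := m.restrict K)
      (F := fun n y => ‖f (x n) y - f x₀ y‖) (f := fun _ => (0 : ℝ)) (fun _ => 2 * B)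
      (fun n => (hmeas _).aestronglyMeasurable) (integrable_const _)
      (fun n => .of_forall fun y => by simpa using hB0 _ y)
      ((ae_restrict_mem hK.measurableSet).mono fun y hyK => by
        simpa using ((hxK y hyK).sub_const (f x₀ y)).norm)
    simpa using this
  obtain ⟨n, hn⟩ := ((tendsto_order.1 hlim).2 (ε / 2) (by positivity)).exists
  have h2 : ∫ y in Kᶜ, ‖f (x n) y - f x₀ y‖ ∂m ≤ m.real Kᶜ * (2 * B) := by
    refine (integral_mono (hint (x n)).integrableOn (integrable_const (2 * B))
      fun y => hB0 _ y).trans_eq ?_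
    simp
  have h3 := integral_add_compl hK.measurableSet (hint (x n))
  linarith [(hxA n).2]

end SeparateContinuity
-- Integration against elements of `M(S)`, and decomposition into positive measures.
section Integral

open scoped BoundedContinuousFunction

theorem integrable_boundedContinuous {𝕜 S : Type*} [RCLike 𝕜] [TopologicalSpace S]
    [MeasurableSpace S] [BorelSpace S] (m : Measure S) [IsFiniteMeasure m] (f : S →ᵇ 𝕜) :
    Integrable f m :=
  Integrable.of_bound f.continuous.aestronglyMeasurable ‖f‖ (.of_forall f.norm_coe_le_norm)

variable {𝕜 : Type*} [RCLike 𝕜] {S : Type*} [TopologicalSpace S] [T2Space S] [MeasurableSpace S]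
  [BorelSpace S]

instance (μ : MeasureSpaceOn 𝕜 S) : μ.toVM.variation.Regular := (Subtype.property μ).2

theorem toVM_injective : Function.Injective (MeasureSpaceOn.toVM : MeasureSpaceOn 𝕜 S → _) :=
  Subtype.val_injective

theorem norm_def (μ : MeasureSpaceOn 𝕜 S) : ‖μ‖ = μ.toVM.variation.real Set.univ := rfl

theorem integral_add_fun (μ : MeasureSpaceOn 𝕜 S) (f g : S →ᵇ 𝕜) :
    integral μ (fun x => f x + g x) = integral μ f + integral μ g :=
  VectorMeasure.integral_fun_add (integrable_boundedContinuous _ f)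
    (integrable_boundedContinuous _ g)

theorem integral_mul_fun (μ : MeasureSpaceOn 𝕜 S) (c : 𝕜) (f : S → 𝕜) :
    integral μ (fun x => c * f x) = c * integral μ f :=
  setToFun_smul _ (fun c s x => by
    change (c • x) * μ.toVM s = c • (x * μ.toVM s)
    simp [mul_assoc]) c f

theorem integral_add_measure (μ ν : MeasureSpaceOn 𝕜 S) (f : S →ᵇ 𝕜) :
    integral (μ + ν) f = integral μ f + integral ν f :=
  VectorMeasure.integral_add_vectorMeasure (integrable_boundedContinuous μ.toVM.variation f)
    (integrable_boundedContinuous ν.toVM.variation f)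

/-- The scalar moves from the integrand into the bilinear pairing, which gives the same
operator-valued set function as `c • μ`. Only the dominating variation changes, by the factor `‖c‖`.
-/
theorem integral_smul_measure (c : 𝕜) (μ : MeasureSpaceOn 𝕜 S) (f : S →ᵇ 𝕜) :
    integral (c • μ) f = c * integral μ f := by
  have hf := integrable_boundedContinuous μ.toVM.variation f
  rw [← integral_mul_fun]
  have h1 := VectorMeasure.integral_continuousLinearMap_comp (B := ContinuousLinearMap.mul ℝ 𝕜)
    (C := ContinuousLinearMap.mul ℝ 𝕜 c) hf
  simp only [ContinuousLinearMap.mul_apply'] at h1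
  refine Eq.trans ?_ h1.symm
  have hT : (c • μ.toVM).transpose (ContinuousLinearMap.mul ℝ 𝕜) =
      μ.toVM.transpose (ContinuousLinearMap.mul ℝ 𝕜 ∘L ContinuousLinearMap.mul ℝ 𝕜 c) := by
    ext s hs x
    change x * (c * μ.toVM s) = (c * x) * μ.toVM s
    ring
  have hD : DominatedFinMeasAdditive (c • μ.toVM).variation
      (μ.toVM.transpose (ContinuousLinearMap.mul ℝ 𝕜 ∘L ContinuousLinearMap.mul ℝ 𝕜 c))
      ‖ContinuousLinearMap.mul ℝ 𝕜‖ := by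
    rw [← hT]
    exact dominatedFinMeasAdditive_cbmApplyMeasure (c • μ.toVM) _
  refine ((setToFun_congr_measure_of_integrable ‖c‖ₑ (by simp) ?_
    (dominatedFinMeasAdditive_cbmApplyMeasure μ.toVM _) hD f hf).trans
      (setToFun_congr_left _ _ (congrArg _ hT.symm) f)).symm
  rw [VectorMeasure.variation_smul]
  rfl

theorem integral_sub_measure (μ ν : MeasureSpaceOn 𝕜 S) (f : S →ᵇ 𝕜) :
    integral (μ - ν) f = integral μ f - integral ν f :=
  VectorMeasure.integral_sub_vectorMeasure (integrable_boundedContinuous μ.toVM.variation f)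
    (integrable_boundedContinuous ν.toVM.variation f)

theorem norm_integral_le (μ : MeasureSpaceOn 𝕜 S) (f : S → 𝕜) :
    ‖integral μ f‖ ≤ ∫ x, ‖f x‖ ∂μ.toVM.variation := by
  refine VectorMeasure.norm_integral_le_integral_norm.trans ?_
  exact mul_le_of_le_one_left (integral_nonneg fun _ => norm_nonneg _)
    (ContinuousLinearMap.opNorm_mul_le ℝ 𝕜)

theorem norm_integral_le_of_bound (μ : MeasureSpaceOn 𝕜 S) (f : S → 𝕜) {B : ℝ}
    (hB : ∀ x, ‖f x‖ ≤ B) : ‖integral μ f‖ ≤ B * ‖μ‖ := by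
  refine (norm_integral_le μ f).trans ?_
  refine (integral_mono_of_nonneg (.of_forall fun _ => norm_nonneg _) (integrable_const B)
    (.of_forall hB)).trans_eq ?_
  rw [integral_const, smul_eq_mul, mul_comm]
  rfl

theorem integral_pointMass (x : S) (f : S → 𝕜) : integral (pointMass 𝕜 x) f = f x := by
  refine (VectorMeasure.integral_dirac (B := ContinuousLinearMap.mul ℝ 𝕜) (f := f)).trans ?_
  simp

variable (𝕜) in
/-- A finite regular measure, viewed as an element of `M(S)`. -/
noncomputable def ofMeasure (p : Measure S) [IsFiniteMeasure p] [p.Regular] :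
    MeasureSpaceOn 𝕜 S :=
  ⟨p.toSignedMeasure.mapRange (RCLike.ofRealCLM (K := 𝕜) : ℝ →+ 𝕜)
    (RCLike.ofRealCLM (K := 𝕜)).continuous, by
    have h : (p.toSignedMeasure.mapRange (RCLike.ofRealCLM (K := 𝕜) : ℝ →+ 𝕜)
        (RCLike.ofRealCLM (K := 𝕜)).continuous).variation ≤ p := by
      refine VectorMeasure.variation_le_of_forall_enorm_le fun E hE => ?_
      change ‖RCLike.ofRealCLM (K := 𝕜) (p.toSignedMeasure E)‖ₑ ≤ p E
      simp [hE, Measure.real, ← ofReal_norm]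
    exact ⟨isFiniteMeasure_of_le _ h, regular_of_le h⟩⟩

theorem ofMeasure_apply (p : Measure S) [IsFiniteMeasure p] [p.Regular] {E : Set S}
    (hE : MeasurableSet E) : (ofMeasure 𝕜 p).toVM E = (p.real E : 𝕜) := by
  change RCLike.ofRealCLM (K := 𝕜) (p.toSignedMeasure E) = _
  simp [hE]

theorem variation_ofMeasure (p : Measure S) [IsFiniteMeasure p] [p.Regular] :
    (ofMeasure 𝕜 p).toVM.variation = p := by
  apply le_antisymm
  · refine VectorMeasure.variation_le_of_forall_enorm_le fun E hE => ?_
    rw [ofMeasure_apply p hE]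
    simp [Measure.real, ← ofReal_norm]
  · refine Measure.le_iff.2 fun E hE => ?_
    refine le_trans ?_ (VectorMeasure.enorm_measure_le_variation _ _)
    rw [ofMeasure_apply p hE]
    simp [Measure.real, ← ofReal_norm]

theorem norm_ofMeasure (p : Measure S) [IsFiniteMeasure p] [p.Regular] :
    ‖ofMeasure 𝕜 p‖ = p.real Set.univ := by
  rw [norm_def, variation_ofMeasure]

theorem integral_ofMeasure (p : Measure S) [IsFiniteMeasure p] [p.Regular] (f : S → 𝕜) :
    integral (ofMeasure 𝕜 p) f = ∫ x, f x ∂p := by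
  rw [MeasureTheory.integral_eq_setToFun]
  have h := variation_ofMeasure (𝕜 := 𝕜) p
  have h2 : DominatedFinMeasAdditive p
      ((ofMeasure 𝕜 p).toVM.transpose (ContinuousLinearMap.mul ℝ 𝕜))
      ‖ContinuousLinearMap.mul ℝ 𝕜‖ := by
    have := dominatedFinMeasAdditive_cbmApplyMeasure (ofMeasure 𝕜 p).toVM
      (ContinuousLinearMap.mul ℝ 𝕜)
    rwa [h] at this
  refine (setToFun_congr_measure 1 1 (by simp) (by simp) (by simp [h]) (by simp [h])
    (dominatedFinMeasAdditive_cbmApplyMeasure (ofMeasure 𝕜 p).toVM _) h2 f).trans ?_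
  refine setToFun_congr_left' _ _ (fun s hs _ => ?_) f
  ext x
  change x * (ofMeasure 𝕜 p).toVM s = p.real s • x
  rw [ofMeasure_apply p hs, RCLike.real_smul_eq_coe_mul, mul_comm]

open scoped ComplexOrder in
theorem isPositive_ofMeasure (p : Measure S) [IsFiniteMeasure p] [p.Regular] :
    IsPositive (ofMeasure 𝕜 p) := fun E hE => by
  rw [ofMeasure_apply p hE]
  exact RCLike.ofReal_nonneg.2 measureReal_nonneg

/-- The real part of an element of `M(S)`. -/
noncomputable def rePart (μ : MeasureSpaceOn 𝕜 S) : SignedMeasure S :=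
  μ.toVM.mapRange (RCLike.reCLM (K := 𝕜) : 𝕜 →+ ℝ) (RCLike.reCLM (K := 𝕜)).continuous

/-- The imaginary part of an element of `M(S)`. -/
noncomputable def imPart (μ : MeasureSpaceOn 𝕜 S) : SignedMeasure S :=
  μ.toVM.mapRange (RCLike.imCLM (K := 𝕜) : 𝕜 →+ ℝ) (RCLike.imCLM (K := 𝕜)).continuous

theorem rePart_apply (μ : MeasureSpaceOn 𝕜 S) (E : Set S) :
    rePart μ E = RCLike.re (μ.toVM E) := rfl

theorem imPart_apply (μ : MeasureSpaceOn 𝕜 S) (E : Set S) :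
    imPart μ E = RCLike.im (μ.toVM E) := rfl

theorem variation_le_of_norm_le_toVM (μ : MeasureSpaceOn 𝕜 S) {σ : SignedMeasure S}
    (h : ∀ E, ‖σ E‖ ≤ ‖μ.toVM E‖) : σ.variation ≤ μ.toVM.variation := by
  refine VectorMeasure.variation_le_of_forall_enorm_le fun E _ => ?_
  refine le_trans ?_ (VectorMeasure.enorm_measure_le_variation _ _)
  rw [← ofReal_norm, ← ofReal_norm]
  exact ENNReal.ofReal_le_ofReal (h E)

/-- Both Jordan parts of `σ` lie below `|μ|`, so they inherit its regularity and have no larger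
mass. Used for the real and imaginary parts of `μ`. -/
theorem exists_eq_toSignedMeasure_sub {σ : SignedMeasure S} {μ : MeasureSpaceOn 𝕜 S}
    (h : ∀ E, ‖σ E‖ ≤ ‖μ.toVM E‖) :
    ∃ a b : MeasureSpaceOn 𝕜 S, IsPositive a ∧ IsPositive b ∧ ‖a‖ ≤ ‖μ‖ ∧ ‖b‖ ≤ ‖μ‖ ∧
      ∀ E, MeasurableSet E → (a - b).toVM E = (σ E : 𝕜) := by
  have hle := variation_le_of_norm_le_toVM μ h
  rw [← SignedMeasure.totalVariation_eq_variation] at hle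
  set j := σ.toJordanDecomposition with hj
  have hp : j.posPart ≤ μ.toVM.variation := le_trans (Measure.le_add_right le_rfl) hle
  have hq : j.negPart ≤ μ.toVM.variation := le_trans (Measure.le_add_left le_rfl) hle
  have : j.posPart.Regular := regular_of_le hp
  have : j.negPart.Regular := regular_of_le hq
  refine ⟨ofMeasure 𝕜 j.posPart, ofMeasure 𝕜 j.negPart, isPositive_ofMeasure _,
    isPositive_ofMeasure _, ?_, ?_, fun E hE => ?_⟩
  · rw [norm_ofMeasure, norm_def]
    exact ENNReal.toReal_mono (measure_ne_top _ _) (hp _)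
  · rw [norm_ofMeasure, norm_def]
    exact ENNReal.toReal_mono (measure_ne_top _ _) (hq _)
  · have hs : j.toSignedMeasure E = σ E := by
      rw [hj, SignedMeasure.toSignedMeasure_toJordanDecomposition]
    rw [JordanDecomposition.toSignedMeasure, Measure.toSignedMeasure_sub_apply hE] at hs
    change (ofMeasure 𝕜 j.posPart).toVM E - (ofMeasure 𝕜 j.negPart).toVM E = _
    rw [ofMeasure_apply _ hE, ofMeasure_apply _ hE, ← hs]
    push_cast
    rfl

/-- Every element of `M(S)` is a linear combination of four positive ones, of no larger norm. -/
theorem exists_positive_decomposition (μ : MeasureSpaceOn 𝕜 S) :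
    ∃ a b c d : MeasureSpaceOn 𝕜 S, (IsPositive a ∧ IsPositive b ∧ IsPositive c ∧ IsPositive d) ∧
      (‖a‖ ≤ ‖μ‖ ∧ ‖b‖ ≤ ‖μ‖ ∧ ‖c‖ ≤ ‖μ‖ ∧ ‖d‖ ≤ ‖μ‖) ∧
      μ = (a - b) + (RCLike.I : 𝕜) • (c - d) := by
  obtain ⟨a, b, ha, hb, hna, hnb, hab⟩ := exists_eq_toSignedMeasure_sub (σ := rePart μ) (μ := μ)
    fun E => RCLike.norm_re_le_norm _
  obtain ⟨c, d, hc, hd, hnc, hnd, hcd⟩ := exists_eq_toSignedMeasure_sub (σ := imPart μ) (μ := μ)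
    fun E => RCLike.norm_im_le_norm _
  refine ⟨a, b, c, d, ⟨ha, hb, hc, hd⟩, ⟨hna, hnb, hnc, hnd⟩,
    toVM_injective (VectorMeasure.ext fun E hE => ?_)⟩
  change _ = (a - b).toVM E + RCLike.I * (c - d).toVM E
  rw [hab E hE, hcd E hE, rePart_apply, imPart_apply, mul_comm, RCLike.re_add_im]

open scoped ComplexOrder in
theorem IsPositive.exists_eq_ofMeasure {μ : MeasureSpaceOn 𝕜 S} (h : IsPositive μ) :
    ∃ (p : Measure S) (_ : IsFiniteMeasure p) (_ : p.Regular), μ = ofMeasure 𝕜 p := by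
  have h0 : 0 ≤[Set.univ] rePart μ :=
    (VectorMeasure.le_restrict_univ_iff_le _ _).2 fun E hE => (RCLike.nonneg_iff.1 (h E hE)).1
  obtain ⟨p, hp, hpμ⟩ : ∃ (p : Measure S) (_ : IsFiniteMeasure p),
      p.toSignedMeasure = rePart μ :=
    ⟨_, inferInstance, SignedMeasure.toMeasureOfZeroLE_toSignedMeasure _ h0⟩
  have hle : p ≤ μ.toVM.variation := by
    rw [← Measure.variation_toSignedMeasure (μ := p), hpμ]
    exact variation_le_of_norm_le_toVM μ fun E => RCLike.norm_re_le_norm _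
  have : p.Regular := regular_of_le hle
  refine ⟨p, hp, this, toVM_injective (VectorMeasure.ext fun E hE => ?_)⟩
  rw [ofMeasure_apply p hE]
  have h1 : p.real E = RCLike.re (μ.toVM E) := by
    rw [← rePart_apply, ← hpμ, Measure.toSignedMeasure_apply_measurable hE]
  rw [h1]
  exact (RCLike.conj_eq_iff_re.1 (RCLike.conj_eq_iff_im.2 (RCLike.nonneg_iff.1 (h E hE)).2)).symm

theorem IsPositive.norm_eq {μ : MeasureSpaceOn 𝕜 S} (h : IsPositive μ) :
    (‖μ‖ : 𝕜) = μ.toVM Set.univ := by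
  obtain ⟨p, _, _, rfl⟩ := h.exists_eq_ofMeasure
  rw [norm_ofMeasure, ofMeasure_apply p .univ]

theorem norm_of_mem_probabilityMeasures {μ : MeasureSpaceOn 𝕜 S}
    (h : μ ∈ probabilityMeasures 𝕜 S) : ‖μ‖ = 1 := by
  have := h.1.norm_eq
  rw [h.2] at this
  exact_mod_cast this

open scoped ComplexOrder in
theorem IsPositive.smul {μ : MeasureSpaceOn 𝕜 S} (h : IsPositive μ) {r : ℝ} (hr : 0 ≤ r) :
    IsPositive ((r : 𝕜) • μ) := fun E hE =>
  mul_nonneg (RCLike.ofReal_nonneg.2 hr) (h E hE)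

open scoped ComplexOrder in
theorem IsPositive.add {μ ν : MeasureSpaceOn 𝕜 S} (h : IsPositive μ) (h' : IsPositive ν) :
    IsPositive (μ + ν) := fun E hE => add_nonneg (h E hE) (h' E hE)

open scoped ComplexOrder in
theorem pointMass_mem (x : S) : pointMass 𝕜 x ∈ probabilityMeasures 𝕜 S := by
  refine ⟨fun E hE => ?_, VectorMeasure.dirac_apply_of_mem .univ trivial⟩
  change 0 ≤ VectorMeasure.dirac x (1 : 𝕜) E
  by_cases hx : x ∈ E
  · rw [VectorMeasure.dirac_apply_of_mem hE hx]; exact zero_le_one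
  · rw [VectorMeasure.dirac_apply_of_notMem hx]

/-- A positive measure is a nonnegative multiple of a probability measure. -/
theorem IsPositive.exists_smul [Nonempty S] {μ : MeasureSpaceOn 𝕜 S} (h : IsPositive μ) :
    ∃ ν ∈ probabilityMeasures 𝕜 S, μ = (‖μ‖ : 𝕜) • ν := by
  by_cases h0 : ‖μ‖ = 0
  · refine ⟨pointMass 𝕜 (Classical.arbitrary S), pointMass_mem _, ?_⟩
    rw [h0, norm_eq_zero.1 h0]
    simp
  · have hne : (‖μ‖ : 𝕜) ≠ 0 := by exact_mod_cast h0
    refine ⟨((‖μ‖⁻¹ : ℝ) : 𝕜) • μ, ⟨h.smul (by positivity), ?_⟩, ?_⟩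
    · change ((‖μ‖⁻¹ : ℝ) : 𝕜) * μ.toVM Set.univ = 1
      rw [← h.norm_eq, ← RCLike.ofReal_mul, inv_mul_cancel₀ h0, RCLike.ofReal_one]
    · rw [smul_smul, ← RCLike.ofReal_mul, mul_inv_cancel₀ h0, RCLike.ofReal_one, one_smul]

theorem span_probabilityMeasures [Nonempty S] :
    Submodule.span 𝕜 (probabilityMeasures 𝕜 S) = ⊤ := by
  refine eq_top_iff.2 fun μ _ => ?_
  have key {a : MeasureSpaceOn 𝕜 S} (ha : IsPositive a) :
      a ∈ Submodule.span 𝕜 (probabilityMeasures 𝕜 S) := by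
    obtain ⟨ν, hν, h⟩ := ha.exists_smul
    rw [h]
    exact Submodule.smul_mem _ _ (Submodule.subset_span hν)
  obtain ⟨a, b, c, d, ⟨ha, hb, hc, hd⟩, -, h⟩ := exists_positive_decomposition μ
  rw [h]
  exact add_mem (sub_mem (key ha) (key hb)) (Submodule.smul_mem _ _ (sub_mem (key hc) (key hd)))

/-- The factor 4 counts the positive parts of `μ`, each of norm at most `‖μ‖`. It is not sharp, but
only boundedness matters. -/
theorem norm_map_le_of_positive {E : Type*} [SeminormedAddCommGroup E] [NormedSpace 𝕜 E]
    (T : MeasureSpaceOn 𝕜 S →ₗ[𝕜] E) {C : ℝ} (hC : 0 ≤ C)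
    (h : ∀ μ, IsPositive μ → ‖T μ‖ ≤ C * ‖μ‖) (μ : MeasureSpaceOn 𝕜 S) :
    ‖T μ‖ ≤ 4 * C * ‖μ‖ := by
  obtain ⟨a, b, c, d, ⟨ha, hb, hc, hd⟩, ⟨ha', hb', hc', hd'⟩, hμ⟩ :=
    exists_positive_decomposition μ
  have hI : ‖(RCLike.I : 𝕜)‖ ≤ 1 := by
    rcases eq_or_ne (RCLike.I : 𝕜) 0 with h | h
    · simp [h]
    · exact (RCLike.norm_I_of_ne_zero h).le
  have hT {x : MeasureSpaceOn 𝕜 S} (hx : IsPositive x) (hx' : ‖x‖ ≤ ‖μ‖) :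
      ‖T x‖ ≤ C * ‖μ‖ := (h x hx).trans (by gcongr)
  calc ‖T μ‖ = ‖(T a - T b) + (RCLike.I : 𝕜) • (T c - T d)‖ := by
        conv_lhs => rw [hμ]
        simp only [map_add, map_sub, map_smul]
    _ ≤ (‖T a‖ + ‖T b‖) + 1 * (‖T c‖ + ‖T d‖) := by
        refine (norm_add_le _ _).trans (add_le_add (norm_sub_le _ _) ?_)
        rw [norm_smul]
        exact mul_le_mul hI (norm_sub_le _ _) (norm_nonneg _) zero_le_one
    _ ≤ 4 * C * ‖μ‖ := by linarith [hT ha ha', hT hb hb', hT hc hc', hT hd hd']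

end Integral
-- Existence, bilinearity and boundedness of the convolution.
section Convolution

open Filter Topology
open scoped BoundedContinuousFunction CompactlySupported

theorem abs_integral_integral_mul_le {S : Type*} [TopologicalSpace S] [MeasurableSpace S] [Mul S]
    (p q : Measure S) [IsFiniteMeasure p] [IsFiniteMeasure q] (f : S →ᵇ ℝ) {ε : ℝ}
    (hf : ∀ x, |f x| ≤ ε) :
    |∫ x, ∫ y, f (x * y) ∂q ∂p| ≤ ε * q.real Set.univ * p.real Set.univ := by
  refine norm_integral_le_of_norm_le_const (μ := p) (f := fun x => ∫ y, f (x * y) ∂q)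
    (.of_forall fun x => ?_)
  exact norm_integral_le_of_norm_le_const (μ := q) (f := fun y => f (x * y))
    (.of_forall fun y => hf _)

variable {𝕜 : Type*} [RCLike 𝕜] {S : Type*} [TopologicalSpace S] [T2Space S]
  [LocallyCompactSpace S] [MeasurableSpace S] [BorelSpace S]

/-- Elements of `M(S)` are determined by their integrals against functions in `C₀(S)`. -/
theorem ext_integral {ρ ρ' : MeasureSpaceOn 𝕜 S}
    (h : ∀ f : C₀(S, 𝕜), integral ρ f = integral ρ' f) : ρ = ρ' := by
  obtain ⟨a, b, c, d, ⟨ha, hb, hc, hd⟩, -, hρ⟩ := exists_positive_decomposition (ρ - ρ')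
  obtain ⟨p, _, _, rfl⟩ := ha.exists_eq_ofMeasure
  obtain ⟨q, _, _, rfl⟩ := hb.exists_eq_ofMeasure
  obtain ⟨r, _, _, rfl⟩ := hc.exists_eq_ofMeasure
  obtain ⟨s, _, _, rfl⟩ := hd.exists_eq_ofMeasure
  -- Real test functions separate real from imaginary parts, so uniqueness in the Riesz theorem
  -- applies to each pair of positive measures. Over `ℝ`, where `I = 0`, the second pair drops out.
  have key (f : C_c(S, ℝ)) : (((∫ x, f x ∂p) - ∫ x, f x ∂q : ℝ) : 𝕜) +
      RCLike.I * (((∫ x, f x ∂r) - ∫ x, f x ∂s : ℝ) : 𝕜) = 0 := by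
    let g : C₀(S, 𝕜) := ⟨⟨fun x => (f x : 𝕜), RCLike.continuous_ofReal.comp f.continuous⟩,
      (f.hasCompactSupport.comp_left (g := fun t : ℝ => (t : 𝕜)) (by simp)).is_zero_at_infty⟩
    have hg (m : Measure S) [IsFiniteMeasure m] [m.Regular] :
        integral (ofMeasure 𝕜 m) g.toBCF = ((∫ x, f x ∂m : ℝ) : 𝕜) := by
      rw [integral_ofMeasure]
      exact integral_ofReal
    have h0 : integral (ρ - ρ') g.toBCF = 0 := by
      rw [integral_sub_measure]
      exact sub_eq_zero.2 (h g)
    rw [hρ, integral_add_measure, integral_smul_measure, integral_sub_measure,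
      integral_sub_measure, hg, hg, hg, hg] at h0
    push_cast
    exact h0
  have hpq : p = q := Measure.ext_of_integral_eq_on_compactlySupported fun f => by
    have := congrArg RCLike.re (key f)
    simp only [map_add, RCLike.ofReal_re, RCLike.re_mul_ofReal, RCLike.I_re, zero_mul, add_zero,
      map_zero] at this
    exact sub_eq_zero.1 this
  rw [← sub_eq_zero, hρ]
  subst hpq
  rcases RCLike.I_eq_zero_or_im_I_eq_one (K := 𝕜) with hI | hI
  · simp [hI]
  · have hrs : r = s := Measure.ext_of_integral_eq_on_compactlySupported fun f => by
      have := congrArg RCLike.im (key f)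
      simp only [map_add, RCLike.ofReal_im, RCLike.im_mul_ofReal, hI, one_mul, zero_add,
        map_zero] at this
      exact sub_eq_zero.1 this
    subst hrs
    simp

variable [Mul S] [SeparatelyContinuousMul S]

/-- Two values differ by at most the `L¹(|ν|)`-distance of the corresponding sections of `f (x *
y)`. This continuity makes the outer integral in the convolution formula meaningful. -/
theorem continuous_integral_mul (ν : MeasureSpaceOn 𝕜 S) (f : S →ᵇ 𝕜) :
    Continuous fun x => integral ν fun y => f (x * y) := by
  rw [continuous_iff_continuousAt]
  intro x₀
  rw [ContinuousAt, tendsto_iff_norm_sub_tendsto_zero]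
  refine squeeze_zero (fun _ => norm_nonneg _) (fun x => ?_)
    (tendsto_integral_norm_sub_of_separatelyContinuous (f := fun x y => f (x * y))
      (fun y => f.continuous.comp (continuous_mul_const y))
      (fun x => f.continuous.comp (continuous_const_mul x))
      (fun x y => f.norm_coe_le_norm (x * y)) ν.toVM.variation x₀)
  have hint (x : S) : Integrable (fun y => f (x * y)) ν.toVM.variation :=
    integrable_boundedContinuous _ (f.compContinuous ⟨fun y => x * y, continuous_const_mul x⟩)
  have h : integral ν (fun y => f (x * y) - f (x₀ * y)) =
      integral ν (fun y => f (x * y)) - integral ν fun y => f (x₀ * y) :=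
    VectorMeasure.integral_fun_sub (hint x) (hint x₀)
  rw [← h]
  exact norm_integral_le _ _

/-- The function `x ↦ ∫ f (x y) dν(y)`. -/
noncomputable def average (ν : MeasureSpaceOn 𝕜 S) (f : S →ᵇ 𝕜) : S →ᵇ 𝕜 :=
  BoundedContinuousFunction.ofNormedAddCommGroup (fun x => integral ν fun y => f (x * y))
    (continuous_integral_mul ν f) (‖f‖ * ‖ν‖)
    fun x => norm_integral_le_of_bound ν _ fun y => f.norm_coe_le_norm (x * y)

theorem average_apply (ν : MeasureSpaceOn 𝕜 S) (f : S →ᵇ 𝕜) (x : S) :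
    average ν f x = integral ν fun y => f (x * y) := rfl

theorem average_ofMeasure_apply (p : Measure S) [IsFiniteMeasure p] [p.Regular] (f : S →ᵇ 𝕜)
    (x : S) : average (ofMeasure 𝕜 p) f x = ∫ y, f (x * y) ∂p :=
  integral_ofMeasure _ _

theorem average_add (ν ν' : MeasureSpaceOn 𝕜 S) (f : S →ᵇ 𝕜) :
    average (ν + ν') f = average ν f + average ν' f := by
  ext x
  exact integral_add_measure ν ν' (f.compContinuous ⟨fun y => x * y, continuous_const_mul x⟩)

theorem average_smul (c : 𝕜) (ν : MeasureSpaceOn 𝕜 S) (f : S →ᵇ 𝕜) :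
    average (c • ν) f = c • average ν f := by
  ext x
  exact integral_smul_measure c ν (f.compContinuous ⟨fun y => x * y, continuous_const_mul x⟩)

/-- Functions in `C₀(S)` are uniform limits of functions with compact support. -/
theorem exists_compactlySupported_abs_sub_le {X : Type*} [TopologicalSpace X] [R1Space X]
    (f : C₀(X, ℝ)) {ε : ℝ} (hε : 0 < ε) : ∃ g : C_c(X, ℝ), ∀ x, |f x - g x| ≤ ε := by
  have h := (f.zero_at_infty').eventually (Metric.ball_mem_nhds 0 hε)
  obtain ⟨K, hK, hKf⟩ := Filter.mem_cocompact.1 h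
  -- Subtracting the truncation of `f` to `[-ε, ε]` changes `f` by at most `ε` and leaves 0 wherever
  -- `|f| < ε`, in particular off `K`.
  let g : C(X, ℝ) := ⟨fun x => f x - max (-ε) (min (f x) ε), by
    have := f.continuous
    fun_prop⟩
  refine ⟨⟨g, HasCompactSupport.intro hK fun x hx => ?_⟩, fun x => ?_⟩
  · have hx' : |f x| < ε := by simpa using hKf hx
    obtain ⟨h1, h2⟩ := abs_lt.1 hx'
    change f x - max (-ε) (min (f x) ε) = 0
    rw [min_eq_left h2.le, max_eq_right h1.le, sub_self]
  · change |f x - (f x - max (-ε) (min (f x) ε))| ≤ ε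
    rw [sub_sub_cancel, abs_le]
    exact ⟨le_max_left _ _, max_le (by linarith) (min_le_right _ _)⟩

/-- The convolution of two positive measures, as a measure. -/
theorem exists_measure_conv_real (p q : Measure S) [IsFiniteMeasure p] [IsFiniteMeasure q]
    [p.Regular] [q.Regular] :
    ∃ (r : Measure S) (_ : IsFiniteMeasure r) (_ : r.Regular),
      r.real Set.univ ≤ p.real Set.univ * q.real Set.univ ∧
      ∀ f : C₀(S, ℝ), ∫ x, f x ∂r = ∫ x, ∫ y, f (x * y) ∂q ∂p := by
  have hsec (f : S →ᵇ ℝ) (x : S) : Integrable (fun y => f (x * y)) q :=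
    integrable_boundedContinuous _ (f.compContinuous ⟨fun y => x * y, continuous_const_mul x⟩)
  have hint (f : S →ᵇ ℝ) : Integrable (fun x => ∫ y, f (x * y) ∂q) p :=
    (integrable_boundedContinuous p (average (ofMeasure ℝ q) f)).congr
      (.of_forall fun x => average_ofMeasure_apply q f x)
  let bcf (f : C_c(S, ℝ)) : S →ᵇ ℝ := (f : C₀(S, ℝ)).toBCF
  -- The iterated integral is a positive functional on `C_c`; its Riesz measure is the convolution.
  let Λ : C_c(S, ℝ) →ₚ[ℝ] ℝ :=
    { toFun := fun f => ∫ x, ∫ y, f (x * y) ∂q ∂p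
      map_add' := fun f g => by
        refine Eq.trans ?_ (integral_add (hint (bcf f)) (hint (bcf g)))
        exact integral_congr_ae (.of_forall fun x =>
          integral_add (hsec (bcf f) x) (hsec (bcf g) x))
      map_smul' := fun c f => by
        rw [RingHom.id_apply, ← integral_smul]
        exact integral_congr_ae (.of_forall fun x => integral_smul c fun y => f (x * y))
      monotone' := fun f g hfg =>
        integral_mono (hint (bcf f)) (hint (bcf g)) fun x =>
          integral_mono (hsec (bcf f) x) (hsec (bcf g) x) fun y => hfg (x * y) }
  have hΛ (f : C_c(S, ℝ)) : Λ f = ∫ x, ∫ y, f (x * y) ∂q ∂p := rfl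
  -- A Urysohn function with values in `[0, 1]`, equal to 1 on a compact `K`, bounds the mass of `K`
  -- by `p(S) q(S)`; inner regularity of the open set `S` does the rest.
  have hmass : RealRMK.rieszMeasure Λ Set.univ ≤
      ENNReal.ofReal (p.real Set.univ * q.real Set.univ) := by
    rw [isOpen_univ.measure_eq_iSup_isCompact]
    refine iSup₂_le fun K _ => iSup_le fun hK => ?_
    obtain ⟨f, hfK, -, hfc, hf⟩ := exists_continuous_one_zero_of_isCompact hK isClosed_empty
      (Set.disjoint_empty K)
    let g : C_c(S, ℝ) := ⟨f, hfc⟩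
    refine (RealRMK.rieszMeasure_le_of_eq_one Λ (f := g) (fun x => (hf x).1) hK
      fun x hx => hfK hx).trans (ENNReal.ofReal_le_ofReal ?_)
    rw [hΛ]
    refine (le_abs_self _).trans ((abs_integral_integral_mul_le p q (bcf g) (ε := 1)
      fun x => ?_).trans (by rw [one_mul, mul_comm]))
    exact abs_le.2 ⟨neg_one_lt_zero.le.trans (hf x).1, (hf x).2⟩
  have hfin : IsFiniteMeasure (RealRMK.rieszMeasure Λ) :=
    ⟨hmass.trans_lt ENNReal.ofReal_lt_top⟩
  have hreg : (RealRMK.rieszMeasure Λ).Regular := inferInstance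
  set r := RealRMK.rieszMeasure Λ with hr
  refine ⟨r, hfin, hreg, ENNReal.toReal_le_of_le_ofReal (by positivity) hmass, fun f => ?_⟩
  -- Passage from `C_c` to `C₀` by uniform approximation: both sides are bounded functionals, with
  -- norms adding up to at most `C`. The `+ 1` guards against `C = 0`.
  rw [← sub_eq_zero, ← abs_nonpos_iff]
  refine le_of_forall_pos_le_add fun δ hδ => ?_
  set C := r.real Set.univ + q.real Set.univ * p.real Set.univ with hC
  have hC0 : 0 ≤ C := by positivity
  obtain ⟨g, hg⟩ := exists_compactlySupported_abs_sub_le f (ε := δ / (C + 1)) (by positivity)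
  have hg' (x : S) : |(f.toBCF - bcf g) x| ≤ δ / (C + 1) := hg x
  have h1 : ∫ x, (f.toBCF - bcf g) x ∂r = ∫ x, f x ∂r - ∫ x, g x ∂r :=
    integral_sub (integrable_boundedContinuous r f.toBCF) (integrable_boundedContinuous r (bcf g))
  have h2 : ∫ x, ∫ y, (f.toBCF - bcf g) (x * y) ∂q ∂p =
      (∫ x, ∫ y, f (x * y) ∂q ∂p) - ∫ x, ∫ y, g (x * y) ∂q ∂p := by
    refine Eq.trans ?_ (integral_sub (hint f.toBCF) (hint (bcf g)))
    exact integral_congr_ae (.of_forall fun x =>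
      integral_sub (hsec f.toBCF x) (hsec (bcf g) x))
  have h3 : ∫ x, g x ∂r = ∫ x, ∫ y, g (x * y) ∂q ∂p := RealRMK.integral_rieszMeasure Λ g
  have h4 : |∫ x, (f.toBCF - bcf g) x ∂r| ≤ δ / (C + 1) * r.real Set.univ :=
    norm_integral_le_of_norm_le_const (μ := r) (f := f.toBCF - bcf g) (.of_forall hg')
  have h5 := abs_integral_integral_mul_le p q (f.toBCF - bcf g) hg'
  have h6 : (∫ x, f x ∂r) - ∫ x, ∫ y, f (x * y) ∂q ∂p =
      (∫ x, (f.toBCF - bcf g) x ∂r) - ∫ x, ∫ y, (f.toBCF - bcf g) (x * y) ∂q ∂p := by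
    rw [h1, h2, h3]; ring
  rw [h6, zero_add]
  refine (abs_sub _ _).trans ((add_le_add h4 h5).trans ?_)
  calc _ = δ / (C + 1) * C := by rw [hC]; ring
    _ ≤ δ / (C + 1) * (C + 1) := by gcongr; linarith
    _ = δ := by field_simp

theorem exists_measure_conv (p q : Measure S) [IsFiniteMeasure p] [IsFiniteMeasure q]
    [p.Regular] [q.Regular] :
    ∃ (r : Measure S) (_ : IsFiniteMeasure r) (_ : r.Regular),
      r.real Set.univ ≤ p.real Set.univ * q.real Set.univ ∧
      ∀ f : C₀(S, 𝕜), ∫ x, f x ∂r = ∫ x, ∫ y, f (x * y) ∂q ∂p := by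
  obtain ⟨r, h1, h2, h3, h⟩ := exists_measure_conv_real p q
  refine ⟨r, h1, h2, h3, fun f => ?_⟩
  have hsec (x : S) : Integrable (fun y => f (x * y)) q :=
    integrable_boundedContinuous _
      (f.toBCF.compContinuous ⟨fun y => x * y, continuous_const_mul x⟩)
  have hint : Integrable (fun x => ∫ y, f (x * y) ∂q) p :=
    (integrable_boundedContinuous p (average (ofMeasure 𝕜 q) f.toBCF)).congr
      (.of_forall fun x => average_ofMeasure_apply q f.toBCF x)
  have hf : Integrable f r := integrable_boundedContinuous r f.toBCF
  have hlim := f.zero_at_infty'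
  refine RCLike.ext ?_ ?_
  · let g : C₀(S, ℝ) := ⟨⟨fun x => RCLike.re (f x), RCLike.continuous_re.comp f.continuous⟩, by
      have h0 := (RCLike.continuous_re.tendsto (0 : 𝕜)).comp hlim
      rw [map_zero] at h0
      exact h0⟩
    rw [← integral_re hf, ← integral_re hint]
    refine (h g).trans (integral_congr_ae (.of_forall fun x => ?_))
    exact integral_re (hsec x)
  · let g : C₀(S, ℝ) := ⟨⟨fun x => RCLike.im (f x), RCLike.continuous_im.comp f.continuous⟩, by
      have h0 := (RCLike.continuous_im.tendsto (0 : 𝕜)).comp hlim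
      rw [map_zero] at h0
      exact h0⟩
    rw [← integral_im hf, ← integral_im hint]
    refine (h g).trans (integral_congr_ae (.of_forall fun x => ?_))
    exact integral_im (hsec x)

theorem IsPositive.exists_conv {μ ν : MeasureSpaceOn 𝕜 S} (hμ : IsPositive μ)
    (hν : IsPositive ν) : ∃ ρ : MeasureSpaceOn 𝕜 S, ‖ρ‖ ≤ ‖μ‖ * ‖ν‖ ∧
      ∀ f : C₀(S, 𝕜), integral ρ f = integral μ (average ν f.toBCF) := by
  obtain ⟨p, _, _, rfl⟩ := hμ.exists_eq_ofMeasure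
  obtain ⟨q, _, _, rfl⟩ := hν.exists_eq_ofMeasure
  obtain ⟨r, _, _, h, hr⟩ := exists_measure_conv (𝕜 := 𝕜) p q
  refine ⟨ofMeasure 𝕜 r, by simpa only [norm_ofMeasure] using h, fun f => ?_⟩
  rw [integral_ofMeasure, integral_ofMeasure, hr]
  exact integral_congr_ae (.of_forall fun x => (average_ofMeasure_apply q f.toBCF x).symm)

/-- The right-hand side is bilinear in `(μ, ν)` and probability measures span `M(S)`, so the
positive case suffices. Hence the default value 0 in `conv` is never taken. -/
theorem exists_conv [Nonempty S] (μ ν : MeasureSpaceOn 𝕜 S) : ∃ ρ : MeasureSpaceOn 𝕜 S,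
    ∀ f : C₀(S, 𝕜), integral ρ f = integral μ (average ν f.toBCF) := by
  have hμ : μ ∈ Submodule.span 𝕜 (probabilityMeasures 𝕜 S) := by
    rw [span_probabilityMeasures]; trivial
  have hν : ν ∈ Submodule.span 𝕜 (probabilityMeasures 𝕜 S) := by
    rw [span_probabilityMeasures]; trivial
  have hzero (f : S →ᵇ 𝕜) : integral (0 : MeasureSpaceOn 𝕜 S) f = 0 := by
    have := integral_smul_measure (0 : 𝕜) 0 f
    simpa using this
  induction hμ using Submodule.span_induction with
  | zero => exact ⟨0, fun f => (hzero f.toBCF).trans (hzero _).symm⟩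
  | add μ μ' _ _ h h' =>
    obtain ⟨ρ, hρ⟩ := h
    obtain ⟨ρ', hρ'⟩ := h'
    refine ⟨ρ + ρ', fun f => (integral_add_measure ρ ρ' f.toBCF).trans ?_⟩
    rw [integral_add_measure, ← hρ, ← hρ']
    rfl
  | smul c μ _ h =>
    obtain ⟨ρ, hρ⟩ := h
    refine ⟨c • ρ, fun f => (integral_smul_measure c ρ f.toBCF).trans ?_⟩
    rw [integral_smul_measure, ← hρ]
    rfl
  | mem μ hμ =>
    induction hν using Submodule.span_induction with
    | zero =>
      refine ⟨0, fun f => (hzero f.toBCF).trans ?_⟩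
      have h0 : average (0 : MeasureSpaceOn 𝕜 S) f.toBCF = 0 := by
        have := average_smul (0 : 𝕜) (0 : MeasureSpaceOn 𝕜 S) f.toBCF
        simpa using this
      have h1 := integral_mul_fun μ 0 (0 : S → 𝕜)
      simp only [zero_mul] at h1
      rw [h0]
      exact h1.symm
    | add ν ν' _ _ h h' =>
      obtain ⟨ρ, hρ⟩ := h
      obtain ⟨ρ', hρ'⟩ := h'
      refine ⟨ρ + ρ', fun f => (integral_add_measure ρ ρ' f.toBCF).trans ?_⟩
      rw [average_add]
      refine Eq.trans ?_ (integral_add_fun μ _ _).symm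
      rw [← hρ, ← hρ']
      rfl
    | smul c ν _ h =>
      obtain ⟨ρ, hρ⟩ := h
      refine ⟨c • ρ, fun f => (integral_smul_measure c ρ f.toBCF).trans ?_⟩
      rw [average_smul]
      exact (congrArg (c * ·) (hρ f)).trans (integral_mul_fun μ c _).symm
    | mem ν hν => exact (hμ.1.exists_conv hν.1).imp fun ρ h => h.2

theorem integral_conv [Nonempty S] (μ ν : MeasureSpaceOn 𝕜 S) (f : C₀(S, 𝕜)) :
    integral (conv μ ν) f.toBCF = integral μ (average ν f.toBCF) := by
  have h : ∃ ρ : MeasureSpaceOn 𝕜 S, ∀ f : C₀(S, 𝕜),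
      integral ρ f = integral μ fun x => integral ν fun y => f (x * y) := exists_conv μ ν
  rw [conv, dif_pos h]
  exact h.choose_spec f

theorem eq_conv [Nonempty S] {μ ν ρ : MeasureSpaceOn 𝕜 S}
    (h : ∀ f : C₀(S, 𝕜), integral ρ f.toBCF = integral μ (average ν f.toBCF)) :
    conv μ ν = ρ :=
  ext_integral fun f => (integral_conv μ ν f).trans (h f).symm

theorem conv_add_left [Nonempty S] (μ μ' ν : MeasureSpaceOn 𝕜 S) :
    conv (μ + μ') ν = conv μ ν + conv μ' ν :=
  eq_conv fun f => by
    rw [integral_add_measure, integral_add_measure, integral_conv, integral_conv]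

theorem conv_smul_left [Nonempty S] (c : 𝕜) (μ ν : MeasureSpaceOn 𝕜 S) :
    conv (c • μ) ν = c • conv μ ν :=
  eq_conv fun f => by rw [integral_smul_measure, integral_smul_measure, integral_conv]

theorem conv_add_right [Nonempty S] (μ ν ν' : MeasureSpaceOn 𝕜 S) :
    conv μ (ν + ν') = conv μ ν + conv μ ν' :=
  eq_conv fun f => by
    rw [integral_add_measure, average_add, integral_conv, integral_conv]
    exact (integral_add_fun μ _ _).symm

theorem conv_smul_right [Nonempty S] (c : 𝕜) (μ ν : MeasureSpaceOn 𝕜 S) :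
    conv μ (c • ν) = c • conv μ ν :=
  eq_conv fun f => by
    rw [integral_smul_measure, average_smul, integral_conv]
    exact (integral_mul_fun μ c _).symm

/-- Convolution as a bilinear map. -/
noncomputable def convₗ [Nonempty S] :
    MeasureSpaceOn 𝕜 S →ₗ[𝕜] MeasureSpaceOn 𝕜 S →ₗ[𝕜] MeasureSpaceOn 𝕜 S :=
  LinearMap.mk₂ 𝕜 conv conv_add_left conv_smul_left conv_add_right conv_smul_right

@[simp]
theorem convₗ_apply [Nonempty S] (μ ν : MeasureSpaceOn 𝕜 S) : convₗ μ ν = conv μ ν := rfl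

/-- For positive measures the constant is 1; decomposing each variable in turn costs `4 * 4`. Only
the continuity of `convL` depends on this. -/
theorem norm_conv_le [Nonempty S] (μ ν : MeasureSpaceOn 𝕜 S) :
    ‖conv μ ν‖ ≤ 16 * ‖μ‖ * ‖ν‖ := by
  have h1 {a b : MeasureSpaceOn 𝕜 S} (ha : IsPositive a) (hb : IsPositive b) :
      ‖conv a b‖ ≤ ‖a‖ * ‖b‖ := by
    obtain ⟨ρ, hρ, h⟩ := ha.exists_conv hb
    rwa [eq_conv h]
  have h2 {b : MeasureSpaceOn 𝕜 S} (hb : IsPositive b) : ‖conv μ b‖ ≤ 4 * ‖b‖ * ‖μ‖ :=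
    norm_map_le_of_positive (convₗ.flip b) (norm_nonneg b)
      (fun a ha => (h1 ha hb).trans_eq (mul_comm _ _)) μ
  refine (norm_map_le_of_positive (convₗ μ) (C := 4 * ‖μ‖) (by positivity)
    (fun b hb => (h2 hb).trans_eq (by ring)) ν).trans_eq (by ring)

/-- Left convolution by a fixed measure, as a continuous linear map. -/
noncomputable def convL [Nonempty S] (μ : MeasureSpaceOn 𝕜 S) :
    MeasureSpaceOn 𝕜 S →L[𝕜] MeasureSpaceOn 𝕜 S :=
  LinearMap.mkContinuous (convₗ μ) (16 * ‖μ‖) (norm_conv_le μ)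

theorem conv_sub_left [Nonempty S] (μ μ' ν : MeasureSpaceOn 𝕜 S) :
    conv (μ - μ') ν = conv μ ν - conv μ' ν :=
  LinearMap.map_sub₂ convₗ μ μ' ν

end Convolution

theorem pointMass_one_conv {𝕜 : Type*} [RCLike 𝕜] {S : Type*} [Monoid S] [TopologicalSpace S]
    [T2Space S] [LocallyCompactSpace S] [SeparatelyContinuousMul S] [MeasurableSpace S]
    [BorelSpace S] (ν : MeasureSpaceOn 𝕜 S) : conv (pointMass 𝕜 1) ν = ν :=
  eq_conv fun f => by 
    simp only [integral_pointMass, average_apply, one_mul]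

/-! ### Means: construction from almost invariant measures, and lower bounds. -/

section Means

open Filter Topology
open scoped ComplexOrder ComplexConjugate

variable {𝕜 : Type*} [RCLike 𝕜] {S : Type*} [TopologicalSpace S] [T2Space S] [MeasurableSpace S]
  [BorelSpace S]

@[simp]
theorem totalMass_apply (μ : MeasureSpaceOn 𝕜 S) : totalMass 𝕜 S μ = μ.toVM Set.univ := rfl

/-- The complex conjugate of an element of `M(S)`. -/
noncomputable def conjMeasure (μ : MeasureSpaceOn 𝕜 S) : MeasureSpaceOn 𝕜 S :=
  ⟨μ.toVM.mapRange (RCLike.conjCLE (K := 𝕜) : 𝕜 →+ 𝕜) (RCLike.conjCLE (K := 𝕜)).continuous, by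
    have h : (μ.toVM.mapRange (RCLike.conjCLE (K := 𝕜) : 𝕜 →+ 𝕜)
        (RCLike.conjCLE (K := 𝕜)).continuous).variation ≤ μ.toVM.variation := by
      refine VectorMeasure.variation_le_of_forall_enorm_le fun E hE => ?_
      refine le_trans ?_ (VectorMeasure.enorm_measure_le_variation _ _)
      change ‖conj (μ.toVM E)‖ₑ ≤ _
      rw [← ofReal_norm, ← ofReal_norm, RCLike.norm_conj]
    exact ⟨isFiniteMeasure_of_le _ h, regular_of_le h⟩⟩

theorem conjMeasure_apply (μ : MeasureSpaceOn 𝕜 S) (E : Set S) :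
    (conjMeasure μ).toVM E = conj (μ.toVM E) := rfl

theorem norm_conjMeasure_le (μ : MeasureSpaceOn 𝕜 S) : ‖conjMeasure μ‖ ≤ ‖μ‖ := by
  refine ENNReal.toReal_mono (measure_ne_top _ _)
    (VectorMeasure.variation_le_of_forall_enorm_le (fun E hE => ?_) Set.univ)
  refine le_trans ?_ (VectorMeasure.enorm_measure_le_variation _ _)
  rw [conjMeasure_apply, ← ofReal_norm, ← ofReal_norm, RCLike.norm_conj]

theorem IsPositive.conjMeasure_eq {μ : MeasureSpaceOn 𝕜 S} (h : IsPositive μ) :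
    conjMeasure μ = μ := by
  refine toVM_injective (VectorMeasure.ext fun E hE => ?_)
  rw [conjMeasure_apply, RCLike.conj_eq_iff_im]
  exact (RCLike.nonneg_iff.1 (h E hE)).2

/-- The functional `μ ↦ conj ⟨g, conj μ⟩`. -/
noncomputable def conjFunctional (g : StrongDual 𝕜 (MeasureSpaceOn 𝕜 S)) :
    StrongDual 𝕜 (MeasureSpaceOn 𝕜 S) :=
  LinearMap.mkContinuous
    { toFun := fun μ => conj (g (conjMeasure μ))
      map_add' := fun μ ν => by
        have h : conjMeasure (μ + ν) = conjMeasure μ + conjMeasure ν :=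
          toVM_injective (VectorMeasure.ext fun E _ => map_add conj (μ.toVM E) (ν.toVM E))
        rw [h, map_add, map_add]
      map_smul' := fun c μ => by
        have h : conjMeasure (c • μ) = conj c • conjMeasure μ :=
          toVM_injective (VectorMeasure.ext fun E _ => map_mul conj c (μ.toVM E))
        rw [h, map_smul, smul_eq_mul, map_mul, RCLike.conj_conj]
        rfl } ‖g‖ fun μ => by
    change ‖conj (g (conjMeasure μ))‖ ≤ _
    rw [RCLike.norm_conj]
    exact (g.le_opNorm _).trans (by gcongr; exact norm_conjMeasure_le μ)

theorem conjFunctional_apply_of_isPositive (g : StrongDual 𝕜 (MeasureSpaceOn 𝕜 S))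
    {μ : MeasureSpaceOn 𝕜 S} (h : IsPositive μ) : conjFunctional g μ = conj (g μ) := by
  change conj (g (conjMeasure μ)) = _
  rw [h.conjMeasure_eq]

theorem combination_mem_probabilityMeasures {μ ν : MeasureSpaceOn 𝕜 S}
    (hμ : μ ∈ probabilityMeasures 𝕜 S) (hν : ν ∈ probabilityMeasures 𝕜 S) {a b : ℝ} (ha : 0 ≤ a)
    (hb : 0 ≤ b) (hab : a + b = 1) : (a : 𝕜) • μ + (b : 𝕜) • ν ∈ probabilityMeasures 𝕜 S := by
  refine ⟨(hμ.1.smul ha).add (hν.1.smul hb), ?_⟩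
  change (a : 𝕜) * μ.toVM Set.univ + (b : 𝕜) * ν.toVM Set.univ = 1
  rw [hμ.2, hν.2, mul_one, mul_one, ← RCLike.ofReal_add, hab, RCLike.ofReal_one]

/-- A net of asymptotically invariant probability measures yields a topologically left invariant
mean. -/
theorem exists_topologicallyLeftInvariant_mean [Mul S]
    (h : ∀ (s : Finset (probabilityMeasures 𝕜 S)) (k : ℕ), ∃ μ ∈ probabilityMeasures 𝕜 S,
      ∀ ν ∈ s, ‖conv (ν : MeasureSpaceOn 𝕜 S) μ - μ‖ < 1 / ((k : ℝ) + 1)) :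
    ∃ M : StrongDual 𝕜 (StrongDual 𝕜 (MeasureSpaceOn 𝕜 S)),
      IsMean M ∧ IsTopologicallyLeftInvariant M := by
  classical
  choose m hm hinv using fun a : Finset (probabilityMeasures 𝕜 S) × ℕ => h a.1 a.2
  -- Indices pair a finite set of measures with a tolerance. By Banach–Alaoglu the images in the
  -- bidual converge weak-star along an ultrafilter finer than `atTop`, with no passage to subnets.
  let U : Ultrafilter (Finset (probabilityMeasures 𝕜 S) × ℕ) := Ultrafilter.of atTop
  have hU : (U : Filter (Finset (probabilityMeasures 𝕜 S) × ℕ)) ≤ atTop := Ultrafilter.of_le _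
  let J (a : Finset (probabilityMeasures 𝕜 S) × ℕ) :
      WeakDual 𝕜 (StrongDual 𝕜 (MeasureSpaceOn 𝕜 S)) :=
    StrongDual.toWeakDual (NormedSpace.inclusionInDoubleDual 𝕜 _ (m a))
  obtain ⟨M, -, hM⟩ := (WeakDual.isCompact_closedBall
    (0 : StrongDual 𝕜 (StrongDual 𝕜 (MeasureSpaceOn 𝕜 S))) 1).ultrafilter_le_nhds (U.map J)
    (le_principal_iff.2 (Filter.mem_map.2 (Filter.univ_mem' fun a => by
      change NormedSpace.inclusionInDoubleDual 𝕜 _ (m a) ∈ Metric.closedBall _ _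
      exact (mem_closedBall_zero_iff
        (E := StrongDual 𝕜 (StrongDual 𝕜 (MeasureSpaceOn 𝕜 S)))).2 <|
        (NormedSpace.double_dual_bound 𝕜 _ _).trans
        (norm_of_mem_probabilityMeasures (hm a)).le)))
  have hlim (f : StrongDual 𝕜 (MeasureSpaceOn 𝕜 S)) :
      Tendsto (fun a => f (m a)) U (𝓝 (M f)) :=
    ((WeakDual.eval_continuous f).tendsto M).comp hM
  refine ⟨WeakDual.toStrongDual M, ⟨fun f hf => ?_, ?_⟩, fun μ hμ f g hg => ?_⟩
  · change 0 ≤ M f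
    have hpos (a : Finset (probabilityMeasures 𝕜 S) × ℕ) := RCLike.nonneg_iff.1 (hf _ (hm a).1)
    refine RCLike.nonneg_iff.2 ⟨?_, ?_⟩
    · exact ge_of_tendsto' ((RCLike.continuous_re.tendsto _).comp (hlim f)) fun a => (hpos a).1
    · exact tendsto_nhds_unique ((RCLike.continuous_im.tendsto _).comp (hlim f))
        (tendsto_const_nhds.congr fun a => (hpos a).2.symm)
  · exact tendsto_nhds_unique (hlim _) (tendsto_const_nhds.congr fun a => (hm a).2.symm)
  · change M g = M f
    rw [← sub_eq_zero]
    refine tendsto_nhds_unique ((hlim g).sub (hlim f)) (Tendsto.mono_left ?_ hU)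
    have h0 : Tendsto (fun a : Finset (probabilityMeasures 𝕜 S) × ℕ =>
        ‖f‖ * (1 / ((a.2 : ℝ) + 1))) atTop (𝓝 0) := by
      have := (tendsto_one_div_add_atTop_nhds_zero_nat (𝕜 := ℝ)).const_mul ‖f‖
      rw [mul_zero] at this
      refine this.comp ?_
      rw [← prod_atTop_atTop_eq]
      exact tendsto_snd
    refine squeeze_zero_norm' ?_ h0
    filter_upwards [eventually_ge_atTop (({⟨μ, hμ⟩}, 0) :
      Finset (probabilityMeasures 𝕜 S) × ℕ)] with a ha
    rw [hg, ← map_sub]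
    refine (f.le_opNorm _).trans ?_
    gcongr
    exact (hinv a ⟨μ, hμ⟩ (ha.1 (Finset.mem_singleton_self _))).le

variable [Nonempty S]

/-- The functional `g - c • 1` is positive, because positive measures are nonnegative multiples of
probability measures. In the order of `𝕜`, nonnegativity of `M g - c` also says that `M g` is real.
-/
theorem IsMean.le_of_real {M : StrongDual 𝕜 (StrongDual 𝕜 (MeasureSpaceOn 𝕜 S))}
    (hM : IsMean M) {g : StrongDual 𝕜 (MeasureSpaceOn 𝕜 S)} {c : ℝ}
    (hg : ∀ μ ∈ probabilityMeasures 𝕜 S, RCLike.im (g μ) = 0)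
    (hc : ∀ μ ∈ probabilityMeasures 𝕜 S, c ≤ RCLike.re (g μ)) :
    c ≤ RCLike.re (M g) ∧ RCLike.im (M g) = 0 := by
  have h := hM.1 (g - (c : 𝕜) • totalMass 𝕜 S) fun μ hμ => by
    obtain ⟨ν, hν, h⟩ := hμ.exists_smul
    rw [h, map_smul, smul_eq_mul]
    refine mul_nonneg (RCLike.ofReal_nonneg.2 (norm_nonneg _)) ?_
    have h1 : (g - (c : 𝕜) • totalMass 𝕜 S) ν = g ν - (c : 𝕜) * ν.toVM Set.univ := rfl
    rw [h1, hν.2, mul_one, RCLike.nonneg_iff]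
    simp [hg ν hν, hc ν hν]
  rw [map_sub, map_smul, hM.2, smul_eq_mul, mul_one, RCLike.nonneg_iff] at h
  simpa using h

/-- A mean of `g` is bounded below by any lower bound of `g` on the probability measures. -/
theorem IsMean.le_re {M : StrongDual 𝕜 (StrongDual 𝕜 (MeasureSpaceOn 𝕜 S))}
    (hM : IsMean M) {g : StrongDual 𝕜 (MeasureSpaceOn 𝕜 S)} {c : ℝ}
    (hc : ∀ μ ∈ probabilityMeasures 𝕜 S, c ≤ RCLike.re (g μ)) : c ≤ RCLike.re (M g) := by
  rcases RCLike.I_eq_zero_or_im_I_eq_one (K := 𝕜) with hI | hI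
  · exact (hM.le_of_real (fun μ _ => RCLike.im_eq_zero hI _) hc).1
  have hI0 : (RCLike.I : 𝕜) ≠ 0 := fun h => by simp [h] at hI
  have hII : (RCLike.I : 𝕜) * RCLike.I = -1 := RCLike.I_mul_I_of_nonzero hI0
  -- On probability measures `u` is `Re g` and `v` is `-Im g`. As `M v` is real, `I • v` contributes
  -- nothing to `Re (M g)`, and the bound for `u` decides.
  set u := (2⁻¹ : 𝕜) • (g + conjFunctional g) with hu
  set v := ((RCLike.I : 𝕜) * 2⁻¹) • (g - conjFunctional g) with hv
  have hg : g = u - (RCLike.I : 𝕜) • v := by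
    ext μ
    change g μ = 2⁻¹ * (g μ + conjFunctional g μ) -
      RCLike.I * (RCLike.I * 2⁻¹ * (g μ - conjFunctional g μ))
    rw [← mul_assoc RCLike.I, ← mul_assoc RCLike.I, hII]
    field_simp
    ring
  have hu' {μ : MeasureSpaceOn 𝕜 S} (hμ : μ ∈ probabilityMeasures 𝕜 S) :
      u μ = (RCLike.re (g μ) : 𝕜) := by
    change 2⁻¹ * (g μ + conjFunctional g μ) = _
    rw [conjFunctional_apply_of_isPositive g hμ.1, RCLike.add_conj, ← mul_assoc,
      inv_mul_cancel₀ two_ne_zero, one_mul]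
  have hv' {μ : MeasureSpaceOn 𝕜 S} (hμ : μ ∈ probabilityMeasures 𝕜 S) :
      v μ = ((-RCLike.im (g μ) : ℝ) : 𝕜) := by
    change RCLike.I * 2⁻¹ * (g μ - conjFunctional g μ) = _
    rw [conjFunctional_apply_of_isPositive g hμ.1, RCLike.sub_conj]
    have : (RCLike.I : 𝕜) * 2⁻¹ * (2 * RCLike.im (g μ) * RCLike.I) =
        (RCLike.I * RCLike.I) * RCLike.im (g μ) := by
      field_simp
    rw [this, hII]
    push_cast
    ring
  clear_value u v
  have h1 := hM.le_of_real (g := u) (c := c) (fun μ hμ => by rw [hu' hμ, RCLike.ofReal_im])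
    fun μ hμ => by rw [hu' hμ, RCLike.ofReal_re]; exact hc μ hμ
  -- Any lower bound would do: only the reality of `M v` is wanted.
  have h2 := hM.le_of_real (g := v) (c := -‖v‖) (fun μ hμ => by rw [hv' hμ, RCLike.ofReal_im])
    fun μ hμ => by
      have := (RCLike.abs_re_le_norm (v μ)).trans (v.le_opNorm μ)
      rw [norm_of_mem_probabilityMeasures hμ, mul_one] at this
      exact (abs_le.1 this).1
  rw [hg, map_sub, map_smul M, map_sub, smul_eq_mul, RCLike.mul_re, h2.2, RCLike.I_re]
  simpa using h1.1

end Means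

/-! ### The two implications. -/

section Main

open Filter Topology
open scoped ComplexOrder

variable {𝕜 : Type*} [RCLike 𝕜] {S : Type*} [Monoid S] [TopologicalSpace S] [T2Space S]
  [LocallyCompactSpace S] [SeparatelyContinuousMul S] [MeasurableSpace S] [BorelSpace S]

/-- In the presence of a topologically left invariant mean, finitely many probability measures
admit an almost invariant probability measure. -/
theorem IsMean.exists_norm_conv_sub_lt
    {M : StrongDual 𝕜 (StrongDual 𝕜 (MeasureSpaceOn 𝕜 S))} (hM : IsMean M)
    (hinv : IsTopologicallyLeftInvariant M) {ι : Type*} [Fintype ι] {p : ι → MeasureSpaceOn 𝕜 S}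
    (hp : ∀ i, p i ∈ probabilityMeasures 𝕜 S) {ε : ℝ} (hε : 0 < ε) :
    ∃ μ ∈ probabilityMeasures 𝕜 S, ∀ i, ‖conv (p i) μ - μ‖ < ε := by
  classical
  let _ : NormedSpace ℝ (MeasureSpaceOn 𝕜 S) := NormedSpace.restrictScalars ℝ 𝕜 _
  have : IsScalarTower ℝ 𝕜 (MeasureSpaceOn 𝕜 S) := ⟨fun r c x => by
    rw [Algebra.smul_def, mul_smul]; rfl⟩
  let T : MeasureSpaceOn 𝕜 S →L[𝕜] (ι → MeasureSpaceOn 𝕜 S) :=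
    ContinuousLinearMap.pi fun i => convL (p i) - ContinuousLinearMap.id 𝕜 _
  have hT (μ : MeasureSpaceOn 𝕜 S) (i : ι) : T μ i = conv (p i) μ - μ := rfl
  have hconv : Convex ℝ (T '' probabilityMeasures 𝕜 S) := by
    rintro _ ⟨μ, hμ, rfl⟩ _ ⟨ν, hν, rfl⟩ a b ha hb hab
    refine ⟨_, combination_mem_probabilityMeasures hμ hν ha hb hab, ?_⟩
    rw [map_add, map_smul, map_smul]
    rfl
  by_cases h0 : (0 : ι → MeasureSpaceOn 𝕜 S) ∈ closure (T '' probabilityMeasures 𝕜 S)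
  · obtain ⟨_, ⟨μ, hμ, rfl⟩, h⟩ := Metric.mem_closure_iff.1 h0 ε hε
    rw [dist_zero_left, pi_norm_lt_iff hε] at h
    exact ⟨μ, hμ, h⟩
  -- Norm separation gives `0 < u < Re f` on the closed convex set. The coordinates `F i` of `f`
  -- write `f ∘ T` as a sum of differences `F i ∘ convL (p i) - F i`, each of mean zero by
  -- invariance, against `Re M (f ∘ T) ≥ u`.
  · obtain ⟨f, u, hu, hf⟩ := RCLike.geometric_hahn_banach_point_closed (𝕜 := 𝕜)
      hconv.closure isClosed_closure h0
    rw [map_zero, map_zero] at hu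
    let F (i : ι) : StrongDual 𝕜 (MeasureSpaceOn 𝕜 S) :=
      f ∘L ContinuousLinearMap.single 𝕜 (fun _ => MeasureSpaceOn 𝕜 S) i
    have hsum : f ∘L T = ∑ i, (F i ∘L convL (p i) - F i) := by
      ext μ
      rw [_root_.sum_apply, ContinuousLinearMap.comp_apply,
        ← Finset.univ_sum_single (T μ), map_sum]
      refine Finset.sum_congr rfl fun i _ => ?_
      change f (Pi.single i (conv (p i) μ - μ)) =
        f (Pi.single i (conv (p i) μ)) - f (Pi.single i μ)
      rw [Pi.single_sub, map_sub]
    have hzero : M (f ∘L T) = 0 := by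
      rw [hsum, map_sum]
      refine Finset.sum_eq_zero fun i _ => ?_
      rw [map_sub, hinv (p i) (hp i) (F i) (F i ∘L convL (p i)) fun ν => rfl, sub_self]
    have hle := hM.le_re (g := f ∘L T) (c := u) fun μ hμ =>
      (hf _ (subset_closure ⟨μ, hμ, rfl⟩)).le
    rw [hzero, map_zero] at hle
    exact absurd hle (not_le.2 hu)

/-- Since every measure is a combination of finitely many probability measures, almost invariance
under those suffices here; no semifoundation hypothesis is needed. -/
theorem iInf_iSup_norm_conv_le {M : StrongDual 𝕜 (StrongDual 𝕜 (MeasureSpaceOn 𝕜 S))}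
    (hM : IsMean M) (hinv : IsTopologicallyLeftInvariant M) {ι : Type*} [Fintype ι] [Nonempty ι]
    (μs : ι → MeasureSpaceOn 𝕜 S) :
    (⨅ μ : probabilityMeasures 𝕜 S, ⨆ i, ‖conv (μs i) μ‖) ≤ ⨆ i, ‖(μs i).toVM Set.univ‖ := by
  have hspan (i : ι) : μs i ∈ Submodule.span 𝕜 (probabilityMeasures 𝕜 S) := by
    rw [span_probabilityMeasures]; trivial
  choose n c p hcp using fun i => Submodule.mem_span_set'.1 (hspan i)
  refine le_of_forall_pos_le_add fun ε hε => ?_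
  set K := ∑ i, ∑ j, ‖c i j‖ with hK
  have hK0 : 0 ≤ K := by positivity
  -- One `μ` must serve all the probability measures in all the decompositions, hence the sigma
  -- type. The tolerance is divided by `K + 1` to absorb the coefficients, also when `K = 0`.
  obtain ⟨μ, hμ, h⟩ := hM.exists_norm_conv_sub_lt hinv (ι := Σ i, Fin (n i))
    (p := fun s => p s.1 s.2) (fun s => (p s.1 s.2).2) (ε := ε / (K + 1)) (by positivity)
  refine (ciInf_le ⟨0, ?_⟩ (⟨μ, hμ⟩ : probabilityMeasures 𝕜 S)).trans (ciSup_le fun i => ?_)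
  · rintro _ ⟨ν, rfl⟩
    exact Real.iSup_nonneg fun i => norm_nonneg _
  -- The first sum is an error of norm at most `ε`; the coefficients in the second add up to
  -- `μ_i(S)`, since each `p i j` has mass 1.
  have h1 : conv (μs i) μ = (∑ j, c i j • (conv (p i j) μ - μ)) + (∑ j, c i j) • μ := by
    conv_lhs => rw [← hcp i]
    rw [← convₗ_apply, map_sum, LinearMap.sum_apply, Finset.sum_smul, ← Finset.sum_add_distrib]
    refine Finset.sum_congr rfl fun j _ => ?_
    rw [map_smul, LinearMap.smul_apply, convₗ_apply, ← smul_add, sub_add_cancel]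
  have h2 : ∑ j, c i j = (μs i).toVM Set.univ := by
    rw [← totalMass_apply, ← hcp i, map_sum]
    refine Finset.sum_congr rfl fun j _ => ?_
    rw [map_smul, totalMass_apply, (p i j).2.2, smul_eq_mul, mul_one]
  have h3 : ‖∑ j, c i j • (conv (p i j : MeasureSpaceOn 𝕜 S) μ - μ)‖ ≤ ε := by
    calc _ ≤ ∑ j, ‖c i j‖ * (ε / (K + 1)) := by
          refine (norm_sum_le _ _).trans (Finset.sum_le_sum fun j _ => ?_)
          rw [norm_smul]
          gcongr
          exact (h ⟨i, j⟩).le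
      _ = (∑ j, ‖c i j‖) * (ε / (K + 1)) := by rw [Finset.sum_mul]
      _ ≤ (K + 1) * (ε / (K + 1)) := by
          gcongr
          have := Finset.single_le_sum (f := fun i => ∑ j, ‖c i j‖)
            (fun i _ => by positivity) (Finset.mem_univ i)
          exact this.trans (by linarith)
      _ = ε := by field_simp
  have h4 : ‖(μs i).toVM Set.univ‖ ≤ ⨆ i, ‖(μs i).toVM Set.univ‖ :=
    le_ciSup (f := fun i => ‖(μs i).toVM Set.univ‖) (Set.finite_range _).bddAbove i
  rw [h1, h2]
  refine (norm_add_le _ _).trans ?_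
  rw [norm_smul, norm_of_mem_probabilityMeasures hμ, mul_one]
  linarith

/-- The inequality is applied to `p i - δ_1`: its total mass is 0, and `δ_1 * μ = μ` turns `(p i -
δ_1) * μ` into `p i * μ - μ`. -/
theorem exists_norm_conv_sub_lt_of_iInf_le
    (h : ∀ (n : ℕ), 0 < n → ∀ μs : Fin n → MeasureSpaceOn 𝕜 S,
      (⨅ μ : probabilityMeasures 𝕜 S, ⨆ i, ‖conv (μs i) μ‖) ≤ ⨆ i, ‖(μs i).toVM Set.univ‖)
    {n : ℕ} (hn : 0 < n) {p : Fin n → MeasureSpaceOn 𝕜 S}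
    (hp : ∀ i, p i ∈ probabilityMeasures 𝕜 S) {ε : ℝ} (hε : 0 < ε) :
    ∃ μ ∈ probabilityMeasures 𝕜 S, ∀ i, ‖conv (p i) μ - μ‖ < ε := by
  have : Nonempty (probabilityMeasures 𝕜 S) := ⟨⟨pointMass 𝕜 1, pointMass_mem 1⟩⟩
  have hle := h n hn fun i => p i - pointMass 𝕜 1
  have hzero (i : Fin n) : ‖(p i - pointMass 𝕜 1).toVM Set.univ‖ = 0 := by
    rw [← totalMass_apply, map_sub, totalMass_apply, totalMass_apply, (hp i).2,
      (pointMass_mem 1).2, sub_self, norm_zero]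
  rw [iSup_congr hzero, Real.iSup_const_zero] at hle
  obtain ⟨⟨μ, hμ⟩, hlt⟩ := exists_lt_of_ciInf_lt (hle.trans_lt hε)
  refine ⟨μ, hμ, fun i => ?_⟩
  have hi : conv (p i - pointMass 𝕜 1) μ = conv (p i) μ - μ := by
    rw [conv_sub_left, pointMass_one_conv]
  have hbdd : BddAbove (Set.range fun i => ‖conv (p i - pointMass 𝕜 1) μ‖) :=
    (Set.finite_range _).bddAbove
  rw [← hi]
  exact (le_ciSup hbdd i).trans_lt hlt

theorem exists_norm_conv_sub_lt_of_finset
    (h : ∀ (n : ℕ), 0 < n → ∀ μs : Fin n → MeasureSpaceOn 𝕜 S,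
      (⨅ μ : probabilityMeasures 𝕜 S, ⨆ i, ‖conv (μs i) μ‖) ≤ ⨆ i, ‖(μs i).toVM Set.univ‖)
    (s : Finset (probabilityMeasures 𝕜 S)) {ε : ℝ} (hε : 0 < ε) :
    ∃ μ ∈ probabilityMeasures 𝕜 S, ∀ ν ∈ s, ‖conv (ν : MeasureSpaceOn 𝕜 S) μ - μ‖ < ε := by
  rcases s.eq_empty_or_nonempty with hs | hs
  -- The inequality is available only for `n > 0`, so the empty family is treated apart.
  · exact ⟨pointMass 𝕜 1, pointMass_mem 1, fun ν hν => absurd hν (by simp [hs])⟩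
  obtain ⟨μ, hμ, hlt⟩ := exists_norm_conv_sub_lt_of_iInf_le h hs.card_pos
    (p := fun i => (s.equivFin.symm i).1.1) (fun i => (s.equivFin.symm i).1.2) hε
  refine ⟨μ, hμ, fun ν hν => ?_⟩
  have := hlt (s.equivFin ⟨ν, hν⟩)
  rwa [Equiv.symm_apply_apply] at this

end Main
end SemigroupMeasureAlgebra

open SemigroupMeasureAlgebra in
theorem theorem1 (𝕜 : Type*) [RCLike 𝕜] (S : Type*) [Monoid S] [TopologicalSpace S] [T2Space S]
    [LocallyCompactSpace S] [SeparatelyContinuousMul S] [MeasurableSpace S] [BorelSpace S]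
    (hS : IsSemifoundation 𝕜 S) :
    (∃ M : StrongDual 𝕜 (StrongDual 𝕜 (MeasureSpaceOn 𝕜 S)),
        IsMean M ∧ IsTopologicallyLeftInvariant M) ↔
      ∀ (n : ℕ), 0 < n → ∀ μs : Fin n → MeasureSpaceOn 𝕜 S,
        (⨅ μ : probabilityMeasures 𝕜 S, ⨆ i, ‖conv (μs i) μ‖) ≤ ⨆ i, ‖(μs i).toVM Set.univ‖ := by
  constructor
  · rintro ⟨M, hM, hinv⟩ n hn μs
    have : Nonempty (Fin n) := ⟨⟨0, hn⟩⟩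
    exact iInf_iSup_norm_conv_le hM hinv μs
  · intro h
    exact exists_topologicallyLeftInvariant_mean fun s k =>
      exists_norm_conv_sub_lt_of_finset h s Nat.one_div_pos_of_nat
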